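/- \textbf{Setting.} Let $\Omega$ be a separable metric space with its Borel $\sigma$-algebra $\mathcal F$, let $\tau\colon\mathbb R\times\Omega\to\Omega$, $(a,\omega)\mapsto\tau_a\omega$, be a continuous action of $\mathbb R$, and let $\mathbb P$ be a probability measure on $(\Omega,\mathcal F)$ such that (i) $\mathbb P(U)>0$ for every nonempty open $U$; (ii) $\mathbb P(\tau_aA)=\mathbb P(A)$ for all $a\in\mathbb R$ and $A\in\mathcal F$; (iii) if $A\in\mathcal F$ satisfies $\tau_aA=A$ for all $a\in\mathbb R$, then $\mathbb P(A)\in\{0,1\}$. Let $\bar K\colon\Omega\times[-1,1]^2\to\mathbb R$ be measurable and put $K(q,p;\omega):=\bar K(\tau_q\omega,p)$ for $q\in\mathbb R$, $p=(p_1,p_2)\in[-1,1]^2$. Assume that for $\mathbb P$-almost every $\omega$ the function $K(\cdot,\cdot;\omega)$ is $C^1$ on $\mathbb R\times[-1,1]^2$ up to the boundary, and that its gradient points inward on the boundary, i.e. for $i=1,2$: $\partial_{p_i}K<0$ wherever $p_i=1$, and $\partial_{p_i}K>0$ wherever $p_i=-1$. A critical point of $K(\cdot,\cdot;\omega)$ is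 a point of $\mathbb R\times[-1,1]^2$ at which its gradient (with respect to $(q,p_1,p_2)$) vanishes; a saddle point is a critical point that is neither a local maximum nor a local minimum. We say that there is a continuum of critical points if the set of critical points has the cardinality of $\mathbb R$. \textbf{Theorem.} (a) For $\mathbb P$-almost every $\omega$, $K(\cdot,\cdot;\omega)$ has infinitely many critical points. (b) One of the following holds: (1) for $\mathbb P$-almost every $\omega$, $K(\cdot,\cdot;\omega)$ has a continuum of critical points; or (2) for $\mathbb P$-almost every $\omega$, $K(\cdot,\cdot;\omega)$ has infinitely many critical points that are local maxima, and infinitely many critical points that are saddle points or local minima. -/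

import Mathlib

open MeasureTheory Set

/-- `P` is a `τ`-invariant ergodic probability measure for the continuous action `τ` of `ℝ` on `Ω`:
it charges every nonempty open set, it is preserved by every `τ_a`, and every measurable set that is
mapped onto itself by all the `τ_a` has probability `0` or `1`. -/
structure IsInvariantErgodicProb {Ω : Type*} [TopologicalSpace Ω] [MeasurableSpace Ω]
    (τ : Flow ℝ Ω) (P : Measure Ω) : Prop where
  prob : IsProbabilityMeasure P
  pos_of_open : ∀ U : Set Ω, IsOpen U → U.Nonempty → 0 < P U
  preserving : ∀ (a : ℝ) (A : Set Ω), MeasurableSet A → P (τ a '' A) = P A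
  ergodic : ∀ A : Set Ω, MeasurableSet A → (∀ a : ℝ, τ a '' A = A) → P A = 1 ∨ P A = 0

/-- The closed slab `ℝ × [-1,1]²`, as the set of the points `x = (q, p₁, p₂)` of Euclidean
`3`-space with `p₁, p₂ ∈ [-1,1]`. -/
def slab : Set (EuclideanSpace ℝ (Fin 3)) :=
  {x | x 1 ∈ Icc (-1 : ℝ) 1 ∧ x 2 ∈ Icc (-1 : ℝ) 1}

/-- The random function `K(q, p; ω) = K̄(τ_q ω, p)`. Only its values for `(q, p)` in the slab, that
is, the values of `K̄` on `Ω × [-1,1]²`, are ever used. -/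
def stationaryFun {Ω : Type*} [TopologicalSpace Ω] (τ : Flow ℝ Ω) (Kbar : Ω → ℝ → ℝ → ℝ)
    (ω : Ω) (x : EuclideanSpace ℝ (Fin 3)) : ℝ :=
  Kbar (τ (x 0) ω) (x 1) (x 2)

/-- The gradient of `f` over the slab (one-sided at the boundary). -/
noncomputable def slabGrad (f : EuclideanSpace ℝ (Fin 3) → ℝ) (x : EuclideanSpace ℝ (Fin 3)) :
    EuclideanSpace ℝ (Fin 3) :=
  gradientWithin f slab x

/-- The gradient of `f` points (strictly) inward on the boundary of the slab: on each of the four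
faces `p_i = ±1` its component along the outer normal is negative. On an edge of the slab this is
required for both faces that meet there. -/
def GradPointsInward (f : EuclideanSpace ℝ (Fin 3) → ℝ) : Prop :=
  ∀ x ∈ slab,
    (x 1 = 1 → slabGrad f x 1 < 0) ∧ (x 1 = -1 → 0 < slabGrad f x 1) ∧
    (x 2 = 1 → slabGrad f x 2 < 0) ∧ (x 2 = -1 → 0 < slabGrad f x 2)

/-- The set of critical points of `f` in the slab. -/
def critPts (f : EuclideanSpace ℝ (Fin 3) → ℝ) : Set (EuclideanSpace ℝ (Fin 3)) :=
  {x | x ∈ slab ∧ slabGrad f x = 0}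

/-- The critical points of `f` that are local maxima. -/
def localMaxPts (f : EuclideanSpace ℝ (Fin 3) → ℝ) : Set (EuclideanSpace ℝ (Fin 3)) :=
  {x | x ∈ critPts f ∧ IsLocalMaxOn f slab x}

/-- The critical points of `f` that are local minima. -/
def localMinPts (f : EuclideanSpace ℝ (Fin 3) → ℝ) : Set (EuclideanSpace ℝ (Fin 3)) :=
  {x | x ∈ critPts f ∧ IsLocalMinOn f slab x}

/-- The saddle points of `f`: critical points that are neither local maxima nor local minima. -/
def saddlePts (f : EuclideanSpace ℝ (Fin 3) → ℝ) : Set (EuclideanSpace ℝ (Fin 3)) :=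
  {x | x ∈ critPts f ∧ ¬ IsLocalMaxOn f slab x ∧ ¬ IsLocalMinOn f slab x}

/-- A continuum of critical points: the set of critical points has the cardinality of `ℝ`. -/
def HasContinuumOfCritPts (f : EuclideanSpace ℝ (Fin 3) → ℝ) : Prop :=
  Cardinal.mk (critPts f) = Cardinal.continuum

open Filter Topology

theorem convex_slab : Convex ℝ slab := by
  have h : slab = (fun x : EuclideanSpace ℝ (Fin 3) => x 1) ⁻¹' Icc (-1 : ℝ) 1 ∩
      (fun x : EuclideanSpace ℝ (Fin 3) => x 2) ⁻¹' Icc (-1 : ℝ) 1 := rfl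
  rw [h]
  exact ((convex_Icc _ _).linear_preimage (EuclideanSpace.proj (𝕜 := ℝ) (1 : Fin 3)).toLinearMap).inter
    ((convex_Icc _ _).linear_preimage (EuclideanSpace.proj (𝕜 := ℝ) (2 : Fin 3)).toLinearMap)

theorem isClosed_slab : IsClosed slab :=
  (isClosed_Icc.preimage (EuclideanSpace.proj (𝕜 := ℝ) (1 : Fin 3)).continuous).inter
    (isClosed_Icc.preimage (EuclideanSpace.proj (𝕜 := ℝ) (2 : Fin 3)).continuous)

/-- The open slab. -/
def openSlab : Set (EuclideanSpace ℝ (Fin 3)) :=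
  {x | x 1 ∈ Ioo (-1 : ℝ) 1 ∧ x 2 ∈ Ioo (-1 : ℝ) 1}

theorem isOpen_openSlab : IsOpen openSlab :=
  (isOpen_Ioo.preimage (EuclideanSpace.proj (𝕜 := ℝ) (1 : Fin 3)).continuous).inter
    (isOpen_Ioo.preimage (EuclideanSpace.proj (𝕜 := ℝ) (2 : Fin 3)).continuous)

theorem openSlab_subset : openSlab ⊆ slab := fun _ hx =>
  ⟨Ioo_subset_Icc_self hx.1, Ioo_subset_Icc_self hx.2⟩

theorem uniqueDiffOn_slab : UniqueDiffOn ℝ slab := by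
  refine uniqueDiffOn_convex convex_slab ⟨0, ?_⟩
  exact interior_maximal openSlab_subset isOpen_openSlab (by simp [openSlab])

section Gradient

variable {f : EuclideanSpace ℝ (Fin 3) → ℝ}

theorem continuousOn_slabGrad (hf : ContDiffOn ℝ 1 f slab) : ContinuousOn (slabGrad f) slab := by
  have h := hf.continuousOn_fderivWithin uniqueDiffOn_slab le_rfl
  exact (InnerProductSpace.toDual ℝ (EuclideanSpace ℝ (Fin 3))).symm.continuous.comp_continuousOn h

/-- The derivative of `f` along a segment contained in the slab. -/
theorem hasDerivWithinAt_line (hf : ContDiffOn ℝ 1 f slab) {y v : EuclideanSpace ℝ (Fin 3)} {I : Set ℝ}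
    (hI : ∀ s ∈ I, y + s • v ∈ slab) {s : ℝ} (hs : s ∈ I) :
    HasDerivWithinAt (fun s : ℝ => f (y + s • v)) (inner ℝ (slabGrad f (y + s • v)) v) I s := by
  have h1 : HasFDerivWithinAt f _ slab (y + s • v) :=
    (((hf.differentiableOn one_ne_zero) _ (hI s hs)).hasGradientWithinAt).hasFDerivWithinAt
  have h2 : HasDerivWithinAt (fun s : ℝ => y + s • v) v I s := by
    simpa using ((hasDerivWithinAt_id s I).smul_const v).const_add y
  have := h1.comp_hasDerivWithinAt s h2 hI
  simpa [slabGrad, Function.comp_def] using this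

theorem mul_sub_le_of_le_inner_slabGrad (hf : ContDiffOn ℝ 1 f slab) {y v : EuclideanSpace ℝ (Fin 3)}
    {h κ : ℝ} (hI : ∀ s ∈ Icc 0 h, y + s • v ∈ slab)
    (hκ : ∀ s ∈ Icc 0 h, κ ≤ inner ℝ (slabGrad f (y + s • v)) v) {s t : ℝ} (hs : 0 ≤ s) (hst : s ≤ t)
    (ht : t ≤ h) : κ * (t - s) ≤ f (y + t • v) - f (y + s • v) := by
  have hd := fun s (hs : s ∈ Icc 0 h) => hasDerivWithinAt_line hf hI hs
  have hd' : ∀ s ∈ interior (Icc 0 h), HasDerivAt (fun s : ℝ => f (y + s • v))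
      (inner ℝ (slabGrad f (y + s • v)) v) s := fun s hs =>
    (hd s (interior_subset hs)).hasDerivAt (mem_interior_iff_mem_nhds.1 hs)
  refine (convex_Icc 0 h).mul_sub_le_image_sub_of_le_deriv (f := fun s : ℝ => f (y + s • v))
    (fun s hs => (hd s hs).continuousWithinAt)
    (fun s hs => (hd' s hs).differentiableAt.differentiableWithinAt) ?_ s ⟨hs, hst.trans ht⟩ t
    ⟨hs.trans hst, ht⟩ hst
  intro s hs
  rw [(hd' s hs).deriv]
  exact hκ s (interior_subset hs)

/-- The vector `v` does not point out of the slab at `x`. -/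
def Admissible (x v : EuclideanSpace ℝ (Fin 3)) : Prop :=
  (x 1 = 1 → v 1 ≤ 0) ∧ (x 1 = -1 → 0 ≤ v 1) ∧ (x 2 = 1 → v 2 ≤ 0) ∧ (x 2 = -1 → 0 ≤ v 2)

theorem eventually_add_mul_mem_Icc {a u : ℝ} (ha : a ∈ Icc (-1 : ℝ) 1) (h1 : a = 1 → u ≤ 0)
    (h2 : a = -1 → 0 ≤ u) :
    ∃ ρ > 0, ∃ h > 0, ∀ b ∈ Icc (-1 : ℝ) 1, |b - a| < ρ → ∀ s ∈ Icc (0 : ℝ) h,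
      b + s * u ∈ Icc (-1 : ℝ) 1 := by
  obtain ⟨ha1, ha2⟩ := ha
  rcases lt_trichotomy u 0 with hu | hu | hu
  · have ha : -1 < a := lt_of_le_of_ne ha1 fun h => by linarith [h2 h.symm]
    refine ⟨(a + 1) / 2, by linarith, (a + 1) / 2 / (-u), div_pos (by linarith) (by linarith), ?_⟩
    rintro b ⟨hb1, hb2⟩ hba s ⟨hs1, hs2⟩
    rw [le_div_iff₀ (by linarith)] at hs2
    have := abs_lt.1 hba
    constructor <;> nlinarith
  · subst hu
    exact ⟨1, one_pos, 1, one_pos, fun b hb _ s _ => by simpa using hb⟩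
  · have ha : a < 1 := lt_of_le_of_ne ha2 fun h => by linarith [h1 h]
    refine ⟨(1 - a) / 2, by linarith, (1 - a) / 2 / u, div_pos (by linarith) (by linarith), ?_⟩
    rintro b ⟨hb1, hb2⟩ hba s ⟨hs1, hs2⟩
    rw [le_div_iff₀ (by linarith)] at hs2
    have := abs_lt.1 hba
    constructor <;> nlinarith

theorem abs_sub_apply_le_dist (x y : EuclideanSpace ℝ (Fin 3)) (i : Fin 3) : |x i - y i| ≤ dist x y := by
  rw [dist_eq_norm]
  simpa using PiLp.norm_apply_le (x - y) i

theorem Admissible.exists_add_smul_mem {x v : EuclideanSpace ℝ (Fin 3)} (hx : x ∈ slab)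
    (h : Admissible x v) :
    ∃ ρ > 0, ∃ h > 0, ∀ y ∈ slab, dist y x < ρ → ∀ s ∈ Icc (0 : ℝ) h, y + s • v ∈ slab := by
  obtain ⟨ρ₁, hρ₁, h₁, hh₁, H₁⟩ := eventually_add_mul_mem_Icc hx.1 h.1 h.2.1
  obtain ⟨ρ₂, hρ₂, h₂, hh₂, H₂⟩ := eventually_add_mul_mem_Icc hx.2 h.2.2.1 h.2.2.2
  refine ⟨min ρ₁ ρ₂, lt_min hρ₁ hρ₂, min h₁ h₂, lt_min hh₁ hh₂, fun y hy hd s hs => ⟨?_, ?_⟩⟩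
  · simpa using H₁ _ hy.1 ((abs_sub_apply_le_dist y x 1).trans_lt (hd.trans_le (min_le_left _ _))) s
      ⟨hs.1, hs.2.trans (min_le_left _ _)⟩
  · simpa using H₂ _ hy.2 ((abs_sub_apply_le_dist y x 2).trans_lt (hd.trans_le (min_le_right _ _))) s
      ⟨hs.1, hs.2.trans (min_le_right _ _)⟩

theorem GradPointsInward.admissible (hin : GradPointsInward f) {x : EuclideanSpace ℝ (Fin 3)}
    (hx : x ∈ slab) : Admissible x (slabGrad f x) :=
  let h := hin x hx
  ⟨fun e => (h.1 e).le, fun e => (h.2.1 e).le, fun e => (h.2.2.1 e).le, fun e => (h.2.2.2 e).le⟩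

theorem admissible_single_zero (x : EuclideanSpace ℝ (Fin 3)) (σ : ℝ) :
    Admissible x (EuclideanSpace.single 0 σ) := by
  simp [Admissible]

theorem GradPointsInward.admissible_single (hin : GradPointsInward f) {x : EuclideanSpace ℝ (Fin 3)}
    (hx : x ∈ slab) (i : Fin 3) : Admissible x (EuclideanSpace.single i (slabGrad f x i)) := by
  have h := hin.admissible hx
  fin_cases i
  · exact admissible_single_zero _ _
  · simpa [Admissible] using ⟨h.1, h.2.1⟩
  · simpa [Admissible] using ⟨h.2.2.1, h.2.2.2⟩

/-- Along an admissible direction, uniformly near `x`, the increase of `f` is at least linear with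
any rate below the directional derivative at `x`. -/
theorem Admissible.exists_mul_sub_le (hf : ContDiffOn ℝ 1 f slab) {x v : EuclideanSpace ℝ (Fin 3)}
    (hx : x ∈ slab) (hv : Admissible x v) {κ : ℝ} (hκ : κ < inner ℝ (slabGrad f x) v) :
    ∃ ρ > 0, ∃ h > 0, ∀ y ∈ slab, dist y x < ρ →
      (∀ s ∈ Icc (0 : ℝ) h, y + s • v ∈ slab) ∧
      ∀ s t, 0 ≤ s → s ≤ t → t ≤ h → κ * (t - s) ≤ f (y + t • v) - f (y + s • v) := by
  obtain ⟨ρ₁, hρ₁, h₁, hh₁, H₁⟩ := hv.exists_add_smul_mem hx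
  have hc : ∀ᶠ y in 𝓝[slab] x, κ < inner ℝ (slabGrad f y) v :=
    ((continuousOn_slabGrad hf x hx).inner continuousWithinAt_const).eventually_const_lt hκ
  obtain ⟨ρ₂, hρ₂, H₂⟩ := Metric.mem_nhdsWithin_iff.1 hc
  obtain ⟨h₂, hh₂, H₃⟩ : ∃ h₂ > 0, h₂ * ‖v‖ ≤ ρ₂ / 2 := by
    refine ⟨ρ₂ / 2 / (‖v‖ + 1), by positivity, ?_⟩
    rw [div_mul_eq_mul_div, div_le_iff₀ (by positivity)]
    nlinarith [norm_nonneg v]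
  refine ⟨min ρ₁ (ρ₂ / 2), by positivity, min h₁ h₂, by positivity, fun y hy hd => ?_⟩
  have hmem : ∀ s ∈ Icc 0 (min h₁ h₂), y + s • v ∈ slab := fun s hs =>
    H₁ y hy (hd.trans_le (min_le_left _ _)) s ⟨hs.1, hs.2.trans (min_le_left _ _)⟩
  refine ⟨hmem, fun s t hs hst ht => mul_sub_le_of_le_inner_slabGrad hf hmem ?_ hs hst ht⟩
  intro s hs
  refine (H₂ ⟨?_, hmem s hs⟩).le
  have h3 : dist (y + s • v) y ≤ ρ₂ / 2 := by
    rw [dist_eq_norm, add_sub_cancel_left, norm_smul, Real.norm_of_nonneg hs.1]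
    exact (mul_le_mul_of_nonneg_right (hs.2.trans (min_le_right _ _)) (norm_nonneg v)).trans H₃
  have h4 := hd.trans_le (min_le_right _ _)
  rw [Metric.mem_ball]
  linarith [dist_triangle (y + s • v) y x]

theorem slabGrad_eq_zero_of_isLocalMaxOn (hf : ContDiffOn ℝ 1 f slab) (hin : GradPointsInward f)
    {x : EuclideanSpace ℝ (Fin 3)} (hx : x ∈ slab) (hmax : IsLocalMaxOn f slab x) :
    slabGrad f x = 0 := by
  by_contra hg
  have hpos : 0 < inner ℝ (slabGrad f x) (slabGrad f x) := real_inner_self_pos.2 hg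
  obtain ⟨κ, hκ0, hκ⟩ := exists_between hpos
  obtain ⟨ρ, hρ, h, hh, H⟩ := (hin.admissible hx).exists_mul_sub_le hf hx hκ
  obtain ⟨H1, H2⟩ := H x hx (by simpa using hρ)
  have ht : Tendsto (fun s : ℝ => x + s • slabGrad f x) (𝓝[>] 0) (𝓝[slab] x) := by
    refine tendsto_nhdsWithin_iff.2 ⟨?_, ?_⟩
    · have : ContinuousAt (fun s : ℝ => x + s • slabGrad f x) 0 := by fun_prop
      simpa [ContinuousAt] using this.mono_left nhdsWithin_le_nhds
    · filter_upwards [Ioc_mem_nhdsGT hh] with s hs using H1 s ⟨hs.1.le, hs.2⟩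
  obtain ⟨s, hs1, hs2⟩ := ((ht.eventually hmax).and (Ioc_mem_nhdsGT hh)).exists
  have := H2 0 s le_rfl hs2.1.le hs2.2
  have h5 : 0 < κ * s := mul_pos hκ0 hs2.1
  simp only [zero_smul, add_zero, sub_zero] at this
  linarith

/-- Near a noncritical point the strict superlevel set through it is connected and its closure is the
weak superlevel set. -/
theorem exists_nhdsWithin_isPreconnected (hf : ContDiffOn ℝ 1 f slab) (hin : GradPointsInward f)
    {x : EuclideanSpace ℝ (Fin 3)} (hx : x ∈ slab) (hg : slabGrad f x ≠ 0) :
    ∃ U ∈ 𝓝[slab] x, U ⊆ slab ∧ IsPreconnected (U ∩ {y | f x < f y}) ∧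
      ∀ y ∈ U, f x ≤ f y → y ∈ closure (U ∩ {y | f x < f y}) := by
  set g := slabGrad f x with hgdef
  have hpos : 0 < inner ℝ (slabGrad f x) g := real_inner_self_pos.2 hg
  obtain ⟨κ, hκ0, hκ⟩ := exists_between hpos
  obtain ⟨ρ, hρ, h, hh, H⟩ := (hin.admissible hx).exists_mul_sub_le hf hx hκ
  have htop : ∀ᶠ y in 𝓝[slab] x, f x < f (y + h • g) := by
    have hxs : x + h • g ∈ slab := (H x hx (by simpa using hρ)).1 h ⟨hh.le, le_rfl⟩
    have h1 : f x < f (x + h • g) := by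
      have := (H x hx (by simpa using hρ)).2 0 h le_rfl hh.le le_rfl
      have h5 : 0 < κ * h := mul_pos hκ0 hh
      simp only [zero_smul, add_zero, sub_zero] at this
      linarith
    have h2 : Tendsto (fun y => y + h • g) (𝓝[slab] x) (𝓝[slab] (x + h • g)) := by
      refine tendsto_nhdsWithin_iff.2 ⟨?_, ?_⟩
      · have : ContinuousAt (fun y => y + h • g) x := by fun_prop
        exact this.mono_left nhdsWithin_le_nhds
      · filter_upwards [self_mem_nhdsWithin, mem_nhdsWithin_of_mem_nhds (Metric.ball_mem_nhds x hρ)]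
          with y hy hy' using (H y hy hy').1 h ⟨hh.le, le_rfl⟩
    exact h2.eventually ((hf.continuousOn _ hxs).eventually_const_lt h1)
  obtain ⟨r₀, hr₀, Hr₀⟩ := Metric.mem_nhdsWithin_iff.1 htop
  set r := min r₀ ρ
  have hr : 0 < r := lt_min hr₀ hρ
  set V := slab ∩ Metric.ball x r
  have hV : ∀ y ∈ V, y ∈ slab ∧ dist y x < ρ ∧ f x < f (y + h • g) := fun y hy =>
    ⟨hy.1, (Metric.mem_ball.1 hy.2).trans_le (min_le_right _ _),
      Hr₀ ⟨Metric.ball_subset_ball (min_le_left _ _) hy.2, hy.1⟩⟩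
  have hxV : x ∈ V := ⟨hx, Metric.mem_ball_self hr⟩
  set U := {z | ∃ y ∈ V, ∃ s ∈ Icc (0 : ℝ) h, z = y + s • g}
  have hVU : V ⊆ U := fun y hy => ⟨y, hy, 0, ⟨le_rfl, hh.le⟩, by simp⟩
  have hmono : ∀ y ∈ V, ∀ s t, 0 ≤ s → s < t → t ≤ h → f (y + s • g) < f (y + t • g) := by
    intro y hy s t hs hst ht
    have := (H y (hV y hy).1 (hV y hy).2.1).2 s t hs hst.le ht
    have h5 : 0 < κ * (t - s) := mul_pos hκ0 (by linarith)
    linarith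
  refine ⟨U, ?_, ?_, ?_, ?_⟩
  · refine mem_of_superset ?_ hVU
    exact inter_mem self_mem_nhdsWithin (mem_nhdsWithin_of_mem_nhds (Metric.ball_mem_nhds x hr))
  · rintro z ⟨y, hy, s, hs, rfl⟩
    exact (H y (hV y hy).1 (hV y hy).2.1).1 s hs
  · refine isPreconnected_of_forall (x + h • g) ?_
    rintro z ⟨⟨y, hy, s, hs, rfl⟩, hz⟩
    refine ⟨(fun t : ℝ => y + t • g) '' Icc s h ∪ (fun y => y + h • g) '' V, ?_, ?_, ?_, ?_⟩
    · rintro w (⟨t, ht, rfl⟩ | ⟨w, hw, rfl⟩)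
      · refine ⟨⟨y, hy, t, ⟨hs.1.trans ht.1, ht.2⟩, rfl⟩, ?_⟩
        rcases ht.1.eq_or_lt with rfl | hlt
        · exact hz
        · exact lt_trans hz (hmono y hy s t hs.1 hlt ht.2)
      · exact ⟨⟨w, hw, h, ⟨hh.le, le_rfl⟩, rfl⟩, (hV w hw).2.2⟩
    · exact Or.inr ⟨x, hxV, rfl⟩
    · exact Or.inl ⟨s, ⟨le_rfl, hs.2⟩, rfl⟩
    · refine IsPreconnected.union (y + h • g) ⟨h, ⟨hs.2, le_rfl⟩, rfl⟩ ⟨y, hy, rfl⟩ ?_ ?_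
      · exact isPreconnected_Icc.image _ (by fun_prop)
      · refine IsPreconnected.image ?_ _ (by fun_prop)
        exact (convex_slab.inter (convex_ball x r)).isPreconnected
  · rintro z ⟨y, hy, s, hs, rfl⟩ hz
    rcases hs.2.eq_or_lt with rfl | hlt
    · exact subset_closure ⟨⟨y, hy, s, hs, rfl⟩, (hV y hy).2.2⟩
    · have ht : Tendsto (fun t : ℝ => y + t • g) (𝓝[>] s) (𝓝 (y + s • g)) := by
        have : ContinuousAt (fun t : ℝ => y + t • g) s := by fun_prop
        exact this.mono_left nhdsWithin_le_nhds
      refine mem_closure_of_tendsto ht ?_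
      filter_upwards [Ioc_mem_nhdsGT hlt] with t ht
      exact ⟨⟨y, hy, t, ⟨hs.1.trans ht.1.le, ht.2⟩, rfl⟩,
        lt_of_le_of_lt hz (hmono y hy s t hs.1 ht.1 ht.2)⟩

end Gradient

section Superlevel

variable {f : EuclideanSpace ℝ (Fin 3) → ℝ} {c d : ℝ} {x y z : EuclideanSpace ℝ (Fin 3)}

/-- Two points are linked at level `c` if some connected subset of `{f > c}` in the slab contains
both. -/
def Linked (f : EuclideanSpace ℝ (Fin 3) → ℝ) (c : ℝ) (y z : EuclideanSpace ℝ (Fin 3)) : Prop :=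
  ∃ t ⊆ slab ∩ {x | c < f x}, IsPreconnected t ∧ y ∈ t ∧ z ∈ t

/-- The component of `x` in the part of the slab where `f > c`. -/
def superComp (f : EuclideanSpace ℝ (Fin 3) → ℝ) (c : ℝ) (x : EuclideanSpace ℝ (Fin 3)) :
    Set (EuclideanSpace ℝ (Fin 3)) :=
  {z | Linked f c x z}

theorem Linked.symm (h : Linked f c y z) : Linked f c z y := by
  obtain ⟨t, h1, h2, h3, h4⟩ := h
  exact ⟨t, h1, h2, h4, h3⟩

theorem Linked.trans (h : Linked f c x y) (h' : Linked f c y z) : Linked f c x z := by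
  obtain ⟨t, h1, h2, h3, h4⟩ := h
  obtain ⟨t', h1', h2', h3', h4'⟩ := h'
  exact ⟨t ∪ t', union_subset h1 h1', h2.union y h4 h3' h2', Or.inl h3, Or.inr h4'⟩

theorem Linked.mono (h : Linked f d y z) (hcd : c ≤ d) : Linked f c y z := by
  obtain ⟨t, h1, h2⟩ := h
  exact ⟨t, fun x hx => ⟨(h1 hx).1, hcd.trans_lt (h1 hx).2⟩, h2⟩

theorem Linked.right_mem (h : Linked f c y z) : z ∈ slab ∧ c < f z := by
  obtain ⟨t, h1, h2, h3, h4⟩ := h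
  exact h1 h4

theorem Linked.left_mem (h : Linked f c y z) : y ∈ slab ∧ c < f y := h.symm.right_mem

theorem Linked.refl (hy : y ∈ slab) (h : c < f y) : Linked f c y y :=
  ⟨{y}, by simpa using ⟨hy, h⟩, isPreconnected_singleton, rfl, rfl⟩

theorem eventually_linked (hf : ContinuousOn f slab) (hx : x ∈ slab) (h : c < f x) :
    ∀ᶠ y in 𝓝[slab] x, Linked f c x y := by
  have h1 : ∀ᶠ y in 𝓝[slab] x, c < f y := (hf x hx).eventually_const_lt h
  obtain ⟨r, hr, H⟩ := Metric.mem_nhdsWithin_iff.1 h1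
  filter_upwards [self_mem_nhdsWithin, mem_nhdsWithin_of_mem_nhds (Metric.ball_mem_nhds x hr)]
    with y hy hy'
  exact ⟨Metric.ball x r ∩ slab, fun z hz => ⟨hz.2, H hz⟩,
    ((convex_ball x r).inter convex_slab).isPreconnected, ⟨Metric.mem_ball_self hr, hx⟩, hy', hy⟩

theorem isPreconnected_superComp : IsPreconnected (superComp f c x) := by
  refine isPreconnected_of_forall x fun y hy => ?_
  obtain ⟨t, h1, h2, h3, h4⟩ := hy
  exact ⟨t, fun z hz => ⟨t, h1, h2, h3, hz⟩, h3, h4, h2⟩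

theorem superComp_subset : superComp f c x ⊆ slab := fun _ hz => hz.right_mem.1

theorem Linked.exists_gt (hf : ContinuousOn f slab) (h : Linked f c y z) :
    ∃ d > c, Linked f d y z := by
  obtain ⟨t, h1, h2, h3, h4⟩ := h
  refine h2.induction₂' (fun y z => ∃ d > c, Linked f d y z) ?_ ?_ h3 h4
  · intro x hx
    obtain ⟨d, hd1, hd2⟩ := exists_between (show c < f x from (h1 hx).2)
    have := (eventually_linked hf (h1 hx).1 hd2).filter_mono
      (nhdsWithin_mono x fun y hy => (h1 hy).1)
    filter_upwards [this] with y hy using ⟨⟨d, hd1, hy⟩, ⟨d, hd1, hy.symm⟩⟩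
  · rintro x y z - - - ⟨d, hd, h⟩ ⟨d', hd', h'⟩
    exact ⟨min d d', lt_min hd hd', (h.mono (min_le_left _ _)).trans (h'.mono (min_le_right _ _))⟩

theorem mem_slab_of_mem_closure_superComp (h : y ∈ closure (superComp f c x)) : y ∈ slab :=
  closure_minimal superComp_subset isClosed_slab h

theorem le_of_mem_closure_superComp (hf : ContinuousOn f slab) (h : y ∈ closure (superComp f c x)) :
    c ≤ f y := by
  have h1 := (hf y (mem_slab_of_mem_closure_superComp h)).mono (superComp_subset (f := f) (c := c) (x := x))
  have : (𝓝[superComp f c x] y).NeBot := mem_closure_iff_nhdsWithin_neBot.1 h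
  exact ge_of_tendsto h1 (eventually_mem_nhdsWithin.mono fun z hz => hz.right_mem.2.le)

theorem mem_superComp_of_mem_closure (hf : ContinuousOn f slab) (h : y ∈ closure (superComp f c x))
    (hy : c < f y) : y ∈ superComp f c x := by
  have h1 := (eventually_linked hf (mem_slab_of_mem_closure_superComp h) hy).filter_mono
    (nhdsWithin_mono y (superComp_subset (f := f) (c := c) (x := x)))
  have : (𝓝[superComp f c x] y).NeBot := mem_closure_iff_nhdsWithin_neBot.1 h
  obtain ⟨z, hz1, hz2⟩ := (h1.and eventually_mem_nhdsWithin).exists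
  exact Linked.trans hz2 hz1.symm

/-- Near a point of the closure of a component of `{f > c}` which is not a critical point at level
`c` other than a local maximum, the set `{f ≥ c}` is contained in that closure. -/
theorem eventually_mem_closure_superComp (hf : ContDiffOn ℝ 1 f slab) (hin : GradPointsInward f)
    (h : y ∈ closure (superComp f c x)) (hy : y ∈ critPts f → IsLocalMaxOn f slab y) :
    ∀ᶠ z in 𝓝[slab] y, c ≤ f z → z ∈ closure (superComp f c x) := by
  have hys := mem_slab_of_mem_closure_superComp h
  have : (𝓝[superComp f c x] y).NeBot := mem_closure_iff_nhdsWithin_neBot.1 h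
  have hle : 𝓝[superComp f c x] y ≤ 𝓝[slab] y := nhdsWithin_mono y superComp_subset
  rcases (le_of_mem_closure_superComp hf.continuousOn h).eq_or_lt with heq | hlt
  · have hg : slabGrad f y ≠ 0 := by
      intro hg
      obtain ⟨z, hz1, hz2⟩ := (((hy ⟨hys, hg⟩).filter_mono hle).and
        eventually_mem_nhdsWithin).exists
      have := hz2.right_mem.2
      linarith
    obtain ⟨U, hU, hUs, hU1, hU2⟩ := exists_nhdsWithin_isPreconnected hf hin hys hg
    have hsub : U ∩ {z | f y < f z} ⊆ superComp f c x := by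
      obtain ⟨z, hz1, hz2⟩ := (Filter.Eventually.and (hle hU) eventually_mem_nhdsWithin).exists
      intro w hw
      refine Linked.trans hz2 ⟨_, ?_, hU1, ⟨hz1, ?_⟩, hw⟩
      · exact fun v hv => ⟨hUs hv.1, lt_of_eq_of_lt heq hv.2⟩
      · exact lt_of_eq_of_lt heq.symm hz2.right_mem.2
    filter_upwards [hU] with z hz hcz
    exact closure_mono hsub (hU2 z hz (heq ▸ hcz))
  · filter_upwards [eventually_linked hf.continuousOn hys hlt] with z hz _
    exact subset_closure (Linked.trans (mem_superComp_of_mem_closure hf.continuousOn h hlt) hz)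

/-- Mountain pass principle: a bounded component of `{f > c}` without critical points other than
local maxima on its boundary does not grow suddenly as the level decreases. -/
theorem exists_superComp_subset (hf : ContDiffOn ℝ 1 f slab) (hin : GradPointsInward f)
    (hx : x ∈ superComp f c x) (hK : IsCompact (closure (superComp f c x)))
    (hcrit : ∀ y ∈ closure (superComp f c x), y ∈ critPts f → IsLocalMaxOn f slab y)
    {W : Set (EuclideanSpace ℝ (Fin 3))} (hW : IsOpen W) (hKW : closure (superComp f c x) ⊆ W) :
    ∃ d < c, superComp f d x ⊆ W := by
  set C := closure (superComp f c x)
  have h1 : ∃ V, IsOpen V ∧ C ⊆ V ∧ ∀ z ∈ V, z ∈ slab → c ≤ f z → z ∈ C := by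
    refine ⟨interior {z | z ∈ slab → c ≤ f z → z ∈ C}, isOpen_interior, fun y hy => ?_,
      fun z hz => interior_subset hz⟩
    exact mem_interior_iff_mem_nhds.2 (eventually_nhdsWithin_iff.1
      (eventually_mem_closure_superComp hf hin hy (hcrit y hy)))
  obtain ⟨V, hV, hCV, HV⟩ := h1
  obtain ⟨O, hO, hCO, hOV, hOc⟩ := exists_open_between_and_isCompact_closure hK (hV.inter hW)
    (subset_inter hCV hKW)
  have hFc : IsCompact (slab ∩ frontier O) :=
    (hOc.of_isClosed_subset isClosed_frontier frontier_subset_closure).inter_left isClosed_slab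
  have hlt : ∀ y ∈ slab ∩ frontier O, f y < c := by
    intro y hy
    by_contra hcy
    have hyC : y ∈ C := HV y (hOV (frontier_subset_closure hy.2)).1 hy.1 (not_lt.1 hcy)
    rw [hO.frontier_eq] at hy
    exact hy.2.2 (hCO hyC)
  obtain ⟨d, hd, Hd⟩ : ∃ d < c, ∀ y ∈ slab ∩ frontier O, f y ≤ d := by
    rcases (slab ∩ frontier O).eq_empty_or_nonempty with he | hne
    · exact ⟨c - 1, by linarith, by simp [he]⟩
    · obtain ⟨y, hy, Hy⟩ := hFc.exists_isMaxOn hne (hf.continuousOn.mono inter_subset_left)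
      exact ⟨f y, hlt y hy, fun z hz => Hy hz⟩
  refine ⟨d, hd, ?_⟩
  have hsub : superComp f d x ⊆ O := by
    refine isPreconnected_superComp.subset_left_of_subset_union hO
      (isClosed_closure (s := O)).isOpen_compl ?_ ?_ ⟨x, Linked.mono hx hd.le, hCO (subset_closure hx)⟩
    · exact disjoint_compl_right_iff_subset.2 subset_closure
    · intro y hy
      by_cases hyO : y ∈ O
      · exact Or.inl hyO
      · refine Or.inr fun hyc => ?_
        have := Hd y ⟨superComp_subset hy, by rw [hO.frontier_eq]; exact ⟨hyc, hyO⟩⟩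
        linarith [hy.right_mem.2]
  exact fun y hy => (hOV (subset_closure (hsub hy))).2

/-- In the absence of critical points other than local maxima, the superlevel sets of a bounded
component of a superlevel set are connected. -/
theorem linked_of_mem_superComp (hf : ContDiffOn ℝ 1 f slab) (hin : GradPointsInward f)
    (hK : IsCompact (closure (superComp f c x)))
    (hcrit : ∀ y ∈ closure (superComp f c x), y ∈ critPts f → IsLocalMaxOn f slab y)
    (hcd : c ≤ d) (hy : y ∈ superComp f c x) (hz : z ∈ superComp f c x) (hyd : d < f y)
    (hzd : d < f z) : Linked f d y z := by
  by_contra hd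
  set J := {e | c ≤ e ∧ e ≤ d ∧ ¬ Linked f e y z}
  have hJ : J.Nonempty := ⟨d, hcd, le_rfl, hd⟩
  have hJb : BddBelow J := ⟨c, fun e he => he.1⟩
  set e := sInf J
  have hce : c ≤ e := le_csInf hJ fun _ h => h.1
  have hed : e ≤ d := csInf_le hJb ⟨hcd, le_rfl, hd⟩
  have hcyz : Linked f c y z := Linked.trans (Linked.symm hy) hz
  have he : ¬ Linked f e y z := by
    intro he
    obtain ⟨e', he', h⟩ := he.exists_gt hf.continuousOn
    obtain ⟨a, ha, hae⟩ := exists_lt_of_csInf_lt hJ he'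
    exact ha.2.2 (h.mono hae.le)
  have hsub : superComp f e y ⊆ superComp f c x := fun w hw =>
    Linked.trans hy (Linked.mono hw hce)
  have hlt : c < e := lt_of_le_of_ne hce fun h => he (h ▸ hcyz)
  obtain ⟨b, hb, H⟩ := exists_superComp_subset hf hin
    (Linked.refl hy.right_mem.1 (hed.trans_lt hyd))
    (hK.of_isClosed_subset isClosed_closure (closure_mono hsub))
    (fun w hw => hcrit w (closure_mono hsub hw)) (isOpen_compl_singleton (x := z))
    (fun w hw hwz => by
      rw [mem_singleton_iff] at hwz
      subst hwz
      exact he (mem_superComp_of_mem_closure hf.continuousOn hw (hed.trans_lt hzd)))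
  have hb' : ¬ Linked f b y z := fun h => H h rfl
  have : max b c ∈ J := ⟨le_max_right _ _, (max_le (hb.le.trans hed) hcd), fun h =>
    hb' (h.mono (le_max_left _ _))⟩
  exact absurd (csInf_le hJb this) (not_le.2 (max_lt hb hlt))

end Superlevel

section OneDim

variable {φ : ℝ → ℝ} {a b κ ℓ B : ℝ}

/-- From `q`, the function `φ` increases at rate at least `κ` in one of the two directions. -/
def IncreasesFrom (φ : ℝ → ℝ) (κ q : ℝ) : Prop :=
  (∃ ε > 0, ∀ s ∈ Ioo 0 ε, φ q + κ * s ≤ φ (q + s)) ∨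
    ∃ ε > 0, ∀ s ∈ Ioo 0 ε, φ q + κ * s ≤ φ (q - s)

theorem AntitoneOn.add_mul_le_of_increasesFrom (hab : a ≤ b) (hκ : 0 < κ)
    (hφ : AntitoneOn φ (Icc a b)) (h : ∀ q ∈ Ioo a b, IncreasesFrom φ κ q) :
    φ b + κ * ((b - a) / 2) ≤ φ a := by
  rcases hab.eq_or_lt with rfl | hlt
  · simp
  set t := (a + b) / 2 with ht
  have hat : a < t := by linarith
  have htb : t < b := by linarith
  set T := {q | q ∈ Icc a t ∧ φ t + κ * t ≤ φ q + κ * q}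
  have hT : T.Nonempty := ⟨t, ⟨hat.le, le_rfl⟩, le_rfl⟩
  have hTb : BddBelow T := ⟨a, fun q hq => hq.1.1⟩
  set m := sInf T with hm
  have ham : a ≤ m := le_csInf hT fun q hq => hq.1.1
  have hmt : m ≤ t := csInf_le hTb ⟨⟨hat.le, le_rfl⟩, le_rfl⟩
  have hmT : φ t + κ * t ≤ φ m + κ * m := by
    refine le_of_forall_pos_le_add fun ε hε => ?_
    obtain ⟨q, hq, hqm⟩ := exists_lt_of_csInf_lt hT (show sInf T < m + ε / κ by
      rw [← hm]; linarith [div_pos hε hκ])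
    have h1 : m ≤ q := csInf_le hTb hq
    have h2 : φ q ≤ φ m := hφ ⟨ham, by linarith⟩ ⟨hq.1.1, by linarith [hq.1.2]⟩ h1
    have h3 : κ * (q - m) ≤ ε := by
      have : q - m ≤ ε / κ := by linarith
      rwa [le_div_iff₀ hκ, mul_comm] at this
    linarith [hq.2]
  have hma : m = a := by
    by_contra hne
    have ham' : a < m := lt_of_le_of_ne ham (Ne.symm hne)
    rcases h m ⟨ham', by linarith⟩ with ⟨ε, hε, H⟩ | ⟨ε, hε, H⟩
    · obtain ⟨s, hs0, hs⟩ := exists_between (lt_min hε (show 0 < b - m by linarith))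
      have h1 := H s ⟨hs0, hs.trans_le (min_le_left _ _)⟩
      have h4 := hs.trans_le (min_le_right _ _)
      have h2 : φ (m + s) ≤ φ m := hφ ⟨ham, by linarith⟩ ⟨by linarith, by linarith⟩ (by linarith)
      have : 0 < κ * s := mul_pos hκ hs0
      linarith
    · obtain ⟨s, hs0, hs⟩ := exists_between (lt_min hε (show 0 < m - a by linarith))
      have h1 := H s ⟨hs0, hs.trans_le (min_le_left _ _)⟩
      have h4 := hs.trans_le (min_le_right _ _)
      have : m - s ∈ T := ⟨⟨by linarith, by linarith⟩, by linarith⟩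
      linarith [csInf_le hTb this]
  have h5 : φ b ≤ φ t := hφ ⟨hat.le, htb.le⟩ ⟨hab, le_rfl⟩ htb.le
  rw [hma] at hmT
  have : κ * ((b - a) / 2) = κ * t - κ * a := by rw [ht]; ring
  linarith

theorem MonotoneOn.add_mul_le_of_increasesFrom (hab : a ≤ b) (hκ : 0 < κ)
    (hφ : MonotoneOn φ (Icc a b)) (h : ∀ q ∈ Ioo a b, IncreasesFrom φ κ q) :
    φ a + κ * ((b - a) / 2) ≤ φ b := by
  have := AntitoneOn.add_mul_le_of_increasesFrom (φ := fun q => φ (-q)) (a := -b) (b := -a)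
    (by linarith) hκ
    (fun x hx y hy hxy => hφ ⟨by linarith [hy.2], by linarith [hy.1]⟩
      ⟨by linarith [hx.2], by linarith [hx.1]⟩ (by linarith)) ?_
  · simp only [neg_neg] at this
    have e : -a - -b = b - a := by ring
    rwa [e] at this
  · intro q hq
    rcases h (-q) ⟨by linarith [hq.2], by linarith [hq.1]⟩ with ⟨ε, hε, H⟩ | ⟨ε, hε, H⟩
    · refine Or.inr ⟨ε, hε, fun s hs => ?_⟩
      have e : -(q - s) = -q + s := by ring
      simpa only [e] using H s hs
    · refine Or.inl ⟨ε, hε, fun s hs => ?_⟩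
      have e : -(q + s) = -q - s := by ring
      simpa only [e] using H s hs

/-- A quasiconcave function is antitone to the right or monotone to the left of any point. -/
theorem antitoneOn_or_monotoneOn_of_quasiconcave {S : Set ℝ}
    (hq : ∀ x ∈ S, ∀ y ∈ S, ∀ z ∈ S, x < y → y < z → min (φ x) (φ z) ≤ φ y) (t : ℝ) :
    AntitoneOn φ (S ∩ Ici t) ∨ MonotoneOn φ (S ∩ Iic t) := by
  by_contra! H
  obtain ⟨H1, H2⟩ := H
  simp only [AntitoneOn, MonotoneOn, not_forall, not_le] at H1 H2
  obtain ⟨x, hx, y, hy, hxy, h1⟩ := H1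
  obtain ⟨u, hu, w, hw, huw, h2⟩ := H2
  have hxy' : x < y := lt_of_le_of_ne hxy fun e => by rw [e] at h1; exact lt_irrefl _ h1
  have huw' : u < w := lt_of_le_of_ne huw fun e => by rw [e] at h2; exact lt_irrefl _ h2
  have hwx : w ≤ x := le_trans hw.2 hx.2
  rcases le_or_gt (φ w) (φ x) with h | h
  · have := hq u hu.1 w hw.1 y hy.1 huw' (hwx.trans_lt hxy')
    rcases min_le_iff.1 this with h' | h' <;> linarith
  · have := hq u hu.1 x hx.1 y hy.1 (huw'.trans_le hwx) hxy'
    rcases min_le_iff.1 this with h' | h' <;> linarith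

/-- A bounded quasiconcave function without local maxima, in a quantitative sense, on each of a
number of intervals, only exists if this number is not too large. -/
theorem natCast_mul_le_of_quasiconcave {S : Set ℝ} {N : ℕ} {α : ℕ → ℝ} (hN : 0 < N) (hκ : 0 < κ) (hℓ : 0 < ℓ)
    (hq : ∀ x ∈ S, ∀ y ∈ S, ∀ z ∈ S, x < y → y < z → min (φ x) (φ z) ≤ φ y)
    (hα : ∀ k, α k + ℓ ≤ α (k + 1)) (hαS : ∀ k < 2 * N, Icc (α k) (α k + ℓ) ⊆ S)
    (hB : ∀ k < 2 * N, ∀ q ∈ Icc (α k) (α k + ℓ), |φ q| ≤ B)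
    (hinc : ∀ k < 2 * N, ∀ q ∈ Icc (α k) (α k + ℓ), IncreasesFrom φ κ q) :
    N * (κ * (ℓ / 2)) ≤ 2 * B := by
  have hmono : Monotone α := monotone_nat_of_le_succ fun k => by linarith [hα k]
  have hleft : ∀ k < 2 * N, α k ∈ S := fun k hk => hαS k hk ⟨le_rfl, by linarith⟩
  have hright : ∀ k < 2 * N, α k + ℓ ∈ S := fun k hk => hαS k hk ⟨by linarith, le_rfl⟩
  rcases antitoneOn_or_monotoneOn_of_quasiconcave hq (α N) with h | h
  · have key : ∀ j < N, φ (α (N + j) + ℓ) + (j + 1) * (κ * (ℓ / 2)) ≤ φ (α N) := by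
      intro j hj
      have hz : φ (α (N + j) + ℓ) + κ * (ℓ / 2) ≤ φ (α (N + j)) := by
        have := AntitoneOn.add_mul_le_of_increasesFrom (φ := φ) (a := α (N + j))
          (b := α (N + j) + ℓ) (by linarith) hκ
          (h.mono fun q hq => ⟨hαS (N + j) (by omega) hq, (hmono (by omega)).trans hq.1⟩)
          (fun q hq => hinc (N + j) (by omega) q (Ioo_subset_Icc_self hq))
        simpa using this
      induction j with
      | zero => simpa using hz
      | succ j ih =>
        have h1 := ih (by omega) (by
          have := AntitoneOn.add_mul_le_of_increasesFrom (φ := φ) (a := α (N + j))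
            (b := α (N + j) + ℓ) (by linarith) hκ
            (h.mono fun q hq => ⟨hαS (N + j) (by omega) hq, (hmono (by omega)).trans hq.1⟩)
            (fun q hq => hinc (N + j) (by omega) q (Ioo_subset_Icc_self hq))
          simpa using this)
        have h2 : φ (α (N + (j + 1))) ≤ φ (α (N + j) + ℓ) :=
          h ⟨hright _ (by omega), by
            have := hmono (show N ≤ N + j by omega)
            simp only [mem_Ici]; linarith⟩ ⟨hleft _ (by omega), hmono (by omega)⟩ (hα (N + j))
        push_cast
        linarith
    have h1 := key (N - 1) (by omega)
    rw [Nat.cast_sub (by omega)] at h1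
    have h2 := abs_le.1 (hB (N + (N - 1)) (by omega) _ ⟨by linarith, le_rfl⟩)
    have h3 := abs_le.1 (hB N (by omega) _ ⟨le_rfl, by linarith⟩)
    push_cast at h1
    linarith
  · have hz : ∀ j < N, φ (α j) + κ * (ℓ / 2) ≤ φ (α j + ℓ) := by
      intro j hj
      have := MonotoneOn.add_mul_le_of_increasesFrom (φ := φ) (a := α j)
        (b := α j + ℓ) (by linarith) hκ
        (h.mono fun q hq => ⟨hαS j (by omega) hq, hq.2.trans ((hα j).trans (hmono (by omega)))⟩)
        (fun q hq => hinc j (by omega) q (Ioo_subset_Icc_self hq))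
      simpa using this
    have key : ∀ j < N, φ (α 0) + (j + 1) * (κ * (ℓ / 2)) ≤ φ (α j + ℓ) := by
      intro j hj
      induction j with
      | zero => simpa using hz 0 hj
      | succ j ih =>
        have h1 := ih (by omega)
        have h2 : φ (α j + ℓ) ≤ φ (α (j + 1)) :=
          h ⟨hright _ (by omega), (hα j).trans (hmono (by omega))⟩
            ⟨hleft _ (by omega), hmono (by omega)⟩ (hα j)
        have h3 := hz (j + 1) hj
        push_cast
        linarith
    have h1 := key (N - 1) (by omega)
    rw [Nat.cast_sub (by omega)] at h1
    have h2 := abs_le.1 (hB (N - 1) (by omega) _ ⟨by linarith, le_rfl⟩)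
    have h3 := abs_le.1 (hB 0 (by omega) _ ⟨le_rfl, by linarith⟩)
    push_cast at h1
    linarith

end OneDim

section Component

variable {f : EuclideanSpace ℝ (Fin 3) → ℝ} {c : ℝ} {x y : EuclideanSpace ℝ (Fin 3)}

theorem exists_add_smul_mem_superComp (hf : ContDiffOn ℝ 1 f slab) (hy : y ∈ superComp f c x)
    {v : EuclideanSpace ℝ (Fin 3)} (hv : Admissible y v) {κ : ℝ} (hκ0 : 0 ≤ κ)
    (hκ : κ < inner ℝ (slabGrad f y) v) :
    ∃ h > 0, ∀ s ∈ Icc 0 h, y + s • v ∈ superComp f c x ∧ f y + κ * s ≤ f (y + s • v) := by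
  obtain ⟨ρ, hρ, h, hh, H⟩ := hv.exists_mul_sub_le hf hy.right_mem.1 hκ
  obtain ⟨H1, H2⟩ := H y hy.right_mem.1 (by simpa using hρ)
  have H3 : ∀ s ∈ Icc 0 h, f y + κ * s ≤ f (y + s • v) := fun s hs => by
    have := H2 0 s le_rfl hs.1 hs.2
    simp only [zero_smul, add_zero, sub_zero] at this
    linarith
  refine ⟨h, hh, fun s hs => ⟨Linked.trans hy ⟨(fun t : ℝ => y + t • v) '' Icc 0 h, ?_,
    isPreconnected_Icc.image _ (by fun_prop), ⟨0, ⟨le_rfl, hh.le⟩, by simp⟩, ⟨s, hs, rfl⟩⟩, H3 s hs⟩⟩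
  rintro _ ⟨t, ht, rfl⟩
  refine ⟨H1 t ht, ?_⟩
  have h1 := H3 t ht
  have h2 := hy.right_mem.2
  have h3 := mul_nonneg hκ0 ht.1
  change c < f (y + t • v)
  linarith

/-- The sum of the absolute values of the components of the gradient. -/
noncomputable def gradSize (f : EuclideanSpace ℝ (Fin 3) → ℝ) (x : EuclideanSpace ℝ (Fin 3)) : ℝ :=
  ∑ i, |slabGrad f x i|

theorem slabGrad_apply_eq_zero_of_forall_le (hf : ContDiffOn ℝ 1 f slab) (hin : GradPointsInward f)
    (hy : y ∈ superComp f c x) (hmax : ∀ z ∈ superComp f c x, z 0 = y 0 → f z ≤ f y) {i : Fin 3}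
    (hi : i ≠ 0) : slabGrad f y i = 0 := by
  by_contra hg
  have hpos : 0 < slabGrad f y i * slabGrad f y i := mul_self_pos.2 hg
  obtain ⟨κ, hκ0, hκ⟩ := exists_between hpos
  obtain ⟨h, hh, H⟩ := exists_add_smul_mem_superComp hf hy
    (hin.admissible_single hy.right_mem.1 i) hκ0.le
    (by simpa [EuclideanSpace.inner_single_right] using hκ)
  obtain ⟨H1, H2⟩ := H h ⟨hh.le, le_rfl⟩
  have h3 := hmax _ H1 (by simp [hi.symm])
  have h4 := mul_pos hκ0 hh
  linarith

/-- A bounded component of a superlevel set, without critical points other than local maxima, cannot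
pass through too many zones without critical points. -/
theorem natCast_mul_le_of_superComp (hf : ContDiffOn ℝ 1 f slab) (hin : GradPointsInward f)
    (hK : IsCompact (closure (superComp f c x)))
    (hcrit : ∀ y ∈ closure (superComp f c x), y ∈ critPts f → IsLocalMaxOn f slab y)
    {N : ℕ} {α : ℕ → ℝ} {δ ℓ B : ℝ} (hN : 0 < N) (hδ : 0 < δ) (hℓ : 0 < ℓ) (hα : ∀ k, α k + ℓ ≤ α (k + 1))
    (hαS : ∀ k < 2 * N, Icc (α k) (α k + ℓ) ⊆ (fun y => y 0) '' superComp f c x)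
    (hzone : ∀ k < 2 * N, ∀ y ∈ slab, y 0 ∈ Icc (α k) (α k + ℓ) → δ ≤ gradSize f y ∧ |f y| ≤ B) :
    N * (δ / 2 * (ℓ / 2)) ≤ 2 * B := by
  have hcont : Continuous fun y : EuclideanSpace ℝ (Fin 3) => y 0 := by fun_prop
  set S := (fun y : EuclideanSpace ℝ (Fin 3) => y 0) '' superComp f c x with hSdef
  have hS : S.OrdConnected := (isPreconnected_superComp.image _ hcont.continuousOn).ordConnected
  have hex : ∀ q ∈ S, ∃ y ∈ superComp f c x, y 0 = q ∧
      ∀ z ∈ superComp f c x, z 0 = q → f z ≤ f y := by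
    rintro _ ⟨y, hy, rfl⟩
    have hc : IsCompact (closure (superComp f c x) ∩ {z | z 0 = y 0}) :=
      hK.inter_right (isClosed_eq hcont continuous_const)
    obtain ⟨z, hz, Hz⟩ := hc.exists_isMaxOn ⟨y, subset_closure hy, rfl⟩
      (hf.continuousOn.mono fun w hw => mem_slab_of_mem_closure_superComp hw.1)
    have h1 : f y ≤ f z := Hz ⟨subset_closure hy, rfl⟩
    exact ⟨z, mem_superComp_of_mem_closure hf.continuousOn hz.1 (hy.right_mem.2.trans_le h1), hz.2,
      fun w hw hw0 => Hz ⟨subset_closure hw, hw0⟩⟩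
  choose! Y hY1 hY2 hY3 using hex
  refine natCast_mul_le_of_quasiconcave (φ := fun q => f (Y q)) (S := S) hN (by positivity) hℓ
    ?_ hα hαS ?_ ?_
  · intro q₀ h₀ q₁ h₁ q₂ h₂ h01 h12
    by_contra! hlt
    obtain ⟨hl1, hl2⟩ := lt_min_iff.1 hlt
    obtain ⟨t, ht1, ht2, ht3, ht4⟩ := linked_of_mem_superComp hf hin hK hcrit
      (hY1 q₁ h₁).right_mem.2.le (hY1 q₀ h₀) (hY1 q₂ h₂) hl1 hl2
    have hord := (ht2.image _ hcont.continuousOn).ordConnected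
    obtain ⟨w, hw, hwq⟩ := hord.out ⟨_, ht3, hY2 q₀ h₀⟩ ⟨_, ht4, hY2 q₂ h₂⟩ ⟨h01.le, h12.le⟩
    have hwO : w ∈ superComp f c x := Linked.trans (hY1 q₀ h₀)
      (Linked.mono ⟨t, ht1, ht2, ht3, hw⟩ (hY1 q₁ h₁).right_mem.2.le)
    have h3 := hY3 q₁ h₁ w hwO hwq
    have h4 : f (Y q₁) < f w := (ht1 hw).2
    linarith
  · intro k hk q hq
    exact (hzone k hk _ (hY1 q (hαS k hk hq)).right_mem.1 (by rwa [hY2 q (hαS k hk hq)])).2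
  · intro k hk q hq
    have hqS := hαS k hk hq
    have hyO := hY1 q hqS
    have hg := (hzone k hk _ hyO.right_mem.1 (by rwa [hY2 q hqS])).1
    have hmax : ∀ z ∈ superComp f c x, z 0 = Y q 0 → f z ≤ f (Y q) := fun z hz hz0 =>
      hY3 q hqS z hz (hz0.trans (hY2 q hqS))
    rw [gradSize, Fin.sum_univ_three,
      slabGrad_apply_eq_zero_of_forall_le hf hin hyO hmax (i := 1) (by decide),
      slabGrad_apply_eq_zero_of_forall_le hf hin hyO hmax (i := 2) (by decide)] at hg
    simp only [abs_zero, add_zero] at hg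
    have key : ∀ σ : ℝ, δ / 2 < σ * slabGrad f (Y q) 0 →
        ∃ h > 0, ∀ s ∈ Ioo 0 h, f (Y q) + δ / 2 * s ≤ f (Y (q + σ * s)) := by
      intro σ hσ
      obtain ⟨h, hh, H⟩ := exists_add_smul_mem_superComp hf hyO (admissible_single_zero _ σ)
        (κ := δ / 2) (by positivity) (by simpa [EuclideanSpace.inner_single_right] using hσ)
      refine ⟨h, hh, fun s hs => ?_⟩
      obtain ⟨H1, H2⟩ := H s (Ioo_subset_Icc_self hs)
      have e : (Y q + s • EuclideanSpace.single (0 : Fin 3) σ) 0 = q + σ * s := by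
        simp [hY2 q hqS, mul_comm]
      exact H2.trans (hY3 _ ⟨_, H1, e⟩ _ H1 e)
    rcases abs_choice (slabGrad f (Y q) 0) with h | h
    · left
      simpa using key 1 (by linarith)
    · right
      simpa [sub_eq_add_neg] using key (-1) (by linarith)

end Component

section Zones

variable {f : EuclideanSpace ℝ (Fin 3) → ℝ}

/-- Over the slices between `a` and `b`, the gradient of `f` is bounded below, `f` is bounded by `B`
and does not exceed `r`. -/
def IsZone (f : EuclideanSpace ℝ (Fin 3) → ℝ) (a b δ B r : ℝ) : Prop :=
  ∀ y ∈ slab, y 0 ∈ Icc a b → δ ≤ gradSize f y ∧ |f y| ≤ B ∧ f y ≤ r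

theorem isCompact_slab_inter (a b : ℝ) : IsCompact (slab ∩ {y | y 0 ∈ Icc a b}) := by
  have h : IsCompact ((WithLp.toLp 2) '' (univ.pi ![Icc a b, Icc (-1 : ℝ) 1, Icc (-1 : ℝ) 1])) := by
    refine IsCompact.image (isCompact_univ_pi fun i => ?_) (PiLp.continuous_toLp 2 _)
    fin_cases i <;> exact isCompact_Icc
  have hcont : Continuous fun y : EuclideanSpace ℝ (Fin 3) => y 0 := by fun_prop
  refine h.of_isClosed_subset (isClosed_slab.inter (isClosed_Icc.preimage hcont)) ?_
  rintro y ⟨hy, hy0⟩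
  refine ⟨WithLp.ofLp y, ?_, rfl⟩
  intro i _
  fin_cases i
  · exact hy0
  · exact hy.1
  · exact hy.2

theorem convex_slab_inter (a b : ℝ) : Convex ℝ (slab ∩ {y | y 0 ∈ Icc a b}) :=
  convex_slab.inter
    ((convex_Icc _ _).linear_preimage (EuclideanSpace.proj (𝕜 := ℝ) (0 : Fin 3)).toLinearMap)

theorem add_single_zero_mem_slab {x : EuclideanSpace ℝ (Fin 3)} (hx : x ∈ slab) (t : ℝ) :
    x + EuclideanSpace.single 0 t ∈ slab := by
  simpa [slab] using hx

theorem infinite_of_forall_exists_gt_apply {A : Set (EuclideanSpace ℝ (Fin 3))}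
    (h : ∀ R : ℝ, ∃ x ∈ A, R < x 0) : A.Infinite := by
  refine Set.Infinite.of_image (fun x => x 0) (infinite_of_not_bddAbove ?_)
  rintro ⟨R, hR⟩
  obtain ⟨x, hx, hxR⟩ := h R
  exact absurd (hR ⟨x, hx, rfl⟩) (not_le.2 hxR)

/-- Places along the line, far out and far from each other, at which a recurring event occurs. -/
theorem exists_seq_of_frequently {P : ℝ → Prop} (h : ∃ᶠ n : ℕ in atTop, P n) (R T : ℝ) :
    ∃ ν : ℕ → ℝ, (∀ k, ν k + T ≤ ν (k + 1)) ∧ R < ν 0 ∧ ∀ k, P (ν k) := by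
  obtain ⟨φ, hφ, H⟩ := extraction_of_frequently_atTop h
  obtain ⟨D, hD⟩ := exists_nat_ge T
  obtain ⟨m, hm⟩ := exists_nat_gt R
  refine ⟨fun k => φ (m + D * k), fun k => ?_, ?_, fun k => H _⟩
  · have h1 := hφ.add_le_nat D (m + D * k)
    have h2 : D + φ (m + D * k) ≤ φ (m + D * (k + 1)) := by
      have e : m + D * (k + 1) = D + (m + D * k) := by ring
      rw [e]
      exact h1
    have h3 : (D : ℝ) + φ (m + D * k) ≤ φ (m + D * (k + 1)) := by exact_mod_cast h2
    linarith
  · have h1 : (m : ℝ) ≤ φ (m + D * 0) := by exact_mod_cast hφ.le_apply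
    linarith

theorem exists_isLocalMaxOn_slab (hf : ContinuousOn f slab) {α β r : ℝ}
    (hα : ∀ y ∈ slab, y 0 = α → f y ≤ r) (hβ : ∀ y ∈ slab, y 0 = β → f y ≤ r)
    {x : EuclideanSpace ℝ (Fin 3)} (hx : x ∈ slab) (hx0 : x 0 ∈ Icc α β) (hr : r < f x) :
    ∃ z ∈ slab, α < z 0 ∧ IsLocalMaxOn f slab z := by
  obtain ⟨z, hz, Hz⟩ := (isCompact_slab_inter α β).exists_isMaxOn ⟨x, hx, hx0⟩
    (hf.mono inter_subset_left)
  have h1 : f x ≤ f z := Hz ⟨hx, hx0⟩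
  have h2 : α < z 0 := lt_of_le_of_ne hz.2.1 fun e => by linarith [hα z hz.1 e.symm]
  have h3 : z 0 < β := lt_of_le_of_ne hz.2.2 fun e => by linarith [hβ z hz.1 e]
  have hcont : Continuous fun y : EuclideanSpace ℝ (Fin 3) => y 0 := by fun_prop
  refine ⟨z, hz.1, h2, ?_⟩
  filter_upwards [self_mem_nhdsWithin, mem_nhdsWithin_of_mem_nhds
    (hcont.continuousAt.preimage_mem_nhds (Icc_mem_nhds h2 h3))] with w hw hw'
  exact Hz ⟨hw, hw'⟩

theorem superComp_subset_of_slices_le {α β r : ℝ}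
    (hα : ∀ y ∈ slab, y 0 = α → f y ≤ r) (hβ : ∀ y ∈ slab, y 0 = β → f y ≤ r)
    {x : EuclideanSpace ℝ (Fin 3)} (hx0 : x 0 ∈ Icc α β) :
    superComp f r x ⊆ {y | y 0 ∈ Ioo α β} := by
  have hcont : Continuous fun y : EuclideanSpace ℝ (Fin 3) => y 0 := by fun_prop
  intro y hy
  have hord := (isPreconnected_superComp.image _ (hcont.continuousOn (s := superComp f r x))).ordConnected
  have hx : x ∈ superComp f r x := Linked.refl hy.left_mem.1 hy.left_mem.2
  have hne : ∀ q, (∀ y ∈ slab, y 0 = q → f y ≤ r) →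
      q ∉ (fun y : EuclideanSpace ℝ (Fin 3) => y 0) '' superComp f r x := by
    rintro q hq ⟨z, hz, rfl⟩
    linarith [hq z hz.right_mem.1 rfl, hz.right_mem.2]
  constructor
  · by_contra h
    exact hne α hα (hord.out ⟨y, hy, rfl⟩ ⟨x, hx, rfl⟩ ⟨not_lt.1 h, hx0.1⟩)
  · by_contra h
    exact hne β hβ (hord.out ⟨x, hx, rfl⟩ ⟨y, hy, rfl⟩ ⟨hx0.2, not_lt.1 h⟩)

/-- If there are no critical points other than local maxima, a component of a superlevel set contained
in a window can be enlarged until its closure reaches the end of the window. -/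
theorem exists_superComp_reaching (hf : ContDiffOn ℝ 1 f slab) (hin : GradPointsInward f) {α β r : ℝ}
    (hcrit : ∀ y ∈ critPts f, α ≤ y 0 → IsLocalMaxOn f slab y)
    {x : EuclideanSpace ℝ (Fin 3)} (hx : x ∈ slab) (hr : r < f x) (hx0 : x 0 ∈ Icc α β)
    (hsub : superComp f r x ⊆ {y | y 0 ∈ Ioo α β}) :
    ∃ c, x ∈ superComp f c x ∧ superComp f c x ⊆ {y | y 0 ∈ Ioo α β} ∧
      ∃ y ∈ closure (superComp f c x), y 0 = α ∨ y 0 = β := by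
  have hcont : Continuous fun y : EuclideanSpace ℝ (Fin 3) => y 0 := by fun_prop
  set S := {c | superComp f c x ⊆ {y | y 0 ∈ Ioo α β}}
  have hS : r ∈ S := hsub
  obtain ⟨z, hz, Hz⟩ := (isCompact_slab_inter α β).exists_isMinOn ⟨x, hx, hx0⟩
    (hf.continuousOn.mono inter_subset_left)
  have hb : BddBelow S := by
    refine ⟨f z, fun c hc => not_lt.1 fun hlt => ?_⟩
    have hβ0 : (x + EuclideanSpace.single 0 (β - x 0) : EuclideanSpace ℝ (Fin 3)) 0 = β := by simp
    have : Linked f c x (x + EuclideanSpace.single 0 (β - x 0)) := by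
      refine ⟨slab ∩ {y | y 0 ∈ Icc α β}, fun y hy => ⟨hy.1, hlt.trans_le (Hz hy)⟩,
        (convex_slab_inter α β).isPreconnected, ⟨hx, hx0⟩, add_single_zero_mem_slab hx _, ?_⟩
      change _ ∈ Icc α β
      rw [hβ0]
      exact ⟨hx0.1.trans hx0.2, le_rfl⟩
    have h1 := (hc this).2
    rw [hβ0] at h1
    exact lt_irrefl _ h1
  set c := sInf S
  have hxc : x ∈ superComp f c x := Linked.refl hx ((csInf_le hb hS).trans_lt hr)
  have hc : superComp f c x ⊆ {y | y 0 ∈ Ioo α β} := by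
    intro y hy
    obtain ⟨d, hd, h⟩ := Linked.exists_gt hf.continuousOn hy
    obtain ⟨e, he, hed⟩ := exists_lt_of_csInf_lt ⟨r, hS⟩ hd
    exact he (Linked.mono h hed.le)
  have hcl : closure (superComp f c x) ⊆ slab ∩ {y | y 0 ∈ Icc α β} := by
    refine closure_minimal (fun y hy => ⟨superComp_subset hy, Ioo_subset_Icc_self (hc hy)⟩) ?_
    exact isClosed_slab.inter (isClosed_Icc.preimage hcont)
  refine ⟨c, hxc, hc, ?_⟩
  by_contra! H
  obtain ⟨d, hd, hdS⟩ := exists_superComp_subset hf hin hxc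
    ((isCompact_slab_inter α β).of_isClosed_subset isClosed_closure hcl)
    (fun y hy hyc => hcrit y hyc (hcl hy).2.1) (isOpen_Ioo.preimage hcont)
    (fun y hy => ⟨lt_of_le_of_ne (hcl hy).2.1 (Ne.symm (H y hy).1),
      lt_of_le_of_ne (hcl hy).2.2 (H y hy).2⟩)
  exact absurd (csInf_le hb hdS) (not_le.2 hd)

theorem Set.OrdConnected.Ico_subset_of_mem_closure {S : Set ℝ} (hS : S.OrdConnected) {ξ β : ℝ}
    (hξ : ξ ∈ S) (hβ : β ∈ closure S) : Ico ξ β ⊆ S := by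
  intro q hq
  obtain ⟨t, ht, hqt⟩ := ((mem_closure_iff_frequently.1 hβ).and_eventually
    (eventually_gt_nhds hq.2)).exists
  exact hS.out hξ ht ⟨hq.1, hqt.le⟩

theorem Set.OrdConnected.Ioc_subset_of_mem_closure {S : Set ℝ} (hS : S.OrdConnected) {ξ α : ℝ}
    (hξ : ξ ∈ S) (hα : α ∈ closure S) : Ioc α ξ ⊆ S := by
  intro q hq
  obtain ⟨t, ht, hqt⟩ := ((mem_closure_iff_frequently.1 hα).and_eventually
    (eventually_lt_nhds hq.1)).exists
  exact hS.out ht hξ ⟨hqt.le, hq.2⟩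

theorem exists_critPts_not_isLocalMaxOn (hf : ContDiffOn ℝ 1 f slab) (hin : GradPointsInward f)
    {a b δ B r T : ℝ} (hab : a < b) (hδ : 0 < δ) {p : EuclideanSpace ℝ (Fin 3)} (hp : p ∈ slab)
    (haT : -T < a) (hbT : b < T) (hpT : |p 0| < T) {ν : ℕ → ℝ} (hν : ∀ k, ν k + 2 * T ≤ ν (k + 1))
    (hzone : ∀ k, IsZone f (a + ν k) (b + ν k) δ B r ∧ r < f (p + EuclideanSpace.single 0 (ν k))) :
    ∃ y ∈ critPts f, ν 0 - T ≤ y 0 ∧ ¬ IsLocalMaxOn f slab y := by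
  by_contra! hcrit
  have hcont : Continuous fun y : EuclideanSpace ℝ (Fin 3) => y 0 := by fun_prop
  obtain ⟨hpT1, hpT2⟩ := abs_lt.1 hpT
  have hmono : Monotone ν := monotone_nat_of_le_succ fun k => by linarith [hν k]
  have hlt : ∀ {i j}, i < j → ν i + 2 * T ≤ ν j := fun {i j} hij =>
    (hν i).trans (hmono (by omega))
  obtain ⟨N, hN⟩ := exists_nat_gt (2 * B / (δ / 2 * ((b - a) / 2)))
  have hpos : 0 < δ / 2 * ((b - a) / 2) := by
    have : 0 < b - a := by linarith
    positivity
  rw [div_lt_iff₀ hpos] at hN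
  have hB : 0 ≤ B := by
    have h0 : (0 : EuclideanSpace ℝ (Fin 3)) + EuclideanSpace.single 0 (a + ν 0) ∈ slab :=
      add_single_zero_mem_slab (by simp [slab]) _
    exact (abs_nonneg _).trans (((hzone 0).1 _ h0 (by simpa using hab.le)).2.1)
  have hN0 : 0 < N := by
    rcases Nat.eq_zero_or_pos N with rfl | h
    · simp at hN
      linarith
    · exact h
  set m := 2 * N + 1 with hm
  set x := p + EuclideanSpace.single 0 (ν m) with hx
  have hx0 : x 0 = p 0 + ν m := by simp [hx]
  have hxs : x ∈ slab := add_single_zero_mem_slab hp _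
  have hslice : ∀ k, ∀ y ∈ slab, y 0 = a + ν k → f y ≤ r := fun k y hy hy0 =>
    ((hzone k).1 y hy ⟨hy0.ge, by linarith⟩).2.2
  have h1 := hlt (show 2 * N < m by omega)
  have h2 := hlt (show m < m + 1 by omega)
  have h3 := hmono (show 0 ≤ 2 * N by omega)
  have h4 := hmono (show m + 1 ≤ 2 * m by omega)
  have hsub := superComp_subset_of_slices_le (hslice (2 * N)) (hslice (m + 1)) (x := x)
    ⟨by linarith, by linarith⟩
  obtain ⟨c, hxc, hcW, y, hy, hy0⟩ := exists_superComp_reaching hf hin (α := ν 0 - T)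
    (β := ν (2 * m) + T) hcrit hxs (hzone m).2 ⟨by linarith, by linarith⟩ (fun z hz =>
      ⟨by linarith [(hsub hz).1], by linarith [(hsub hz).2]⟩)
  have hcl : closure (superComp f c x) ⊆ slab ∩ {y | y 0 ∈ Icc (ν 0 - T) (ν (2 * m) + T)} :=
    closure_minimal (fun y hy => ⟨superComp_subset hy, Ioo_subset_Icc_self (hcW hy)⟩)
      (isClosed_slab.inter (isClosed_Icc.preimage hcont))
  have hK : IsCompact (closure (superComp f c x)) :=
    (isCompact_slab_inter _ _).of_isClosed_subset isClosed_closure hcl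
  have hcr : ∀ y ∈ closure (superComp f c x), y ∈ critPts f → IsLocalMaxOn f slab y :=
    fun y hy hyc => hcrit y hyc (hcl hy).2.1
  set S := (fun y : EuclideanSpace ℝ (Fin 3) => y 0) '' superComp f c x with hSdef
  have hS : S.OrdConnected := (isPreconnected_superComp.image _ hcont.continuousOn).ordConnected
  have hxS : p 0 + ν m ∈ S := ⟨x, hxc, hx0⟩
  have hyS : y 0 ∈ closure S := mem_closure_image hcont.continuousAt hy
  have key : ∀ j, (∀ k < 2 * N, Icc (a + ν (j + k)) (b + ν (j + k)) ⊆ S) → False := by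
    intro j hj
    have := natCast_mul_le_of_superComp hf hin hK hcr (α := fun k => a + ν (j + k)) (ℓ := b - a)
      (δ := δ) (B := B) hN0 hδ (by linarith) (fun k => by
        have := hν (j + k)
        change a + ν (j + k) + (b - a) ≤ a + ν (j + k + 1)
        linarith)
      (fun k hk => by
        have e : a + ν (j + k) + (b - a) = b + ν (j + k) := by ring
        simp only [e]
        exact hj k hk)
      (fun k hk z hz hz0 => by
        have e : a + ν (j + k) + (b - a) = b + ν (j + k) := by ring
        simp only [e] at hz0
        exact ⟨((hzone (j + k)).1 z hz hz0).1, ((hzone (j + k)).1 z hz hz0).2.1⟩)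
    linarith
  rcases hy0 with hy0 | hy0
  · refine key 0 fun k hk q hq => hS.Ioc_subset_of_mem_closure hxS (hy0 ▸ hyS) ?_
    rw [zero_add] at hq
    have h5 := hmono (show 0 ≤ k by omega)
    have h6 := hlt (show k < m by omega)
    exact ⟨by linarith [hq.1], by linarith [hq.2]⟩
  · refine key (m + 1) fun k hk q hq => hS.Ico_subset_of_mem_closure hxS (hy0 ▸ hyS) ?_
    have h5 := hlt (show m < m + 1 + k by omega)
    have h6 := hlt (show m + 1 + k < 2 * m by omega)
    exact ⟨by linarith [hq.1], by linarith [hq.2]⟩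

theorem infinite_localMaxPts_and_infinite_saddlePts_union (hf : ContDiffOn ℝ 1 f slab)
    (hin : GradPointsInward f) {a b δ B r : ℝ} (hab : a < b) (hδ : 0 < δ)
    {p : EuclideanSpace ℝ (Fin 3)} (hp : p ∈ slab)
    (h : ∃ᶠ n : ℕ in atTop, IsZone f (a + n) (b + n) δ B r ∧
      r < f (p + EuclideanSpace.single 0 (n : ℝ))) :
    (localMaxPts f).Infinite ∧ (saddlePts f ∪ localMinPts f).Infinite := by
  set T := |a| + |b| + |p 0| + 1
  have haT : -T < a := by linarith [neg_abs_le a, abs_nonneg b, abs_nonneg (p 0)]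
  have hbT : b < T := by linarith [le_abs_self b, abs_nonneg a, abs_nonneg (p 0)]
  have hpT : |p 0| < T := by linarith [abs_nonneg a, abs_nonneg b]
  have hseq := exists_seq_of_frequently (P := fun t => IsZone f (a + t) (b + t) δ B r ∧
      r < f (p + EuclideanSpace.single 0 t)) h
  constructor
  · refine infinite_of_forall_exists_gt_apply fun R => ?_
    obtain ⟨ν, hν, hR, H⟩ := hseq (R + T) (2 * T)
    have hslice : ∀ k, ∀ y ∈ slab, y 0 = a + ν k → f y ≤ r := fun k y hy hy0 =>
      ((H k).1 y hy ⟨hy0.ge, by linarith⟩).2.2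
    obtain ⟨hpT1, hpT2⟩ := abs_lt.1 hpT
    have h0 := hν 0
    have h1 := hν 1
    rw [zero_add] at h0
    obtain ⟨z, hz, hz0, hzm⟩ := exists_isLocalMaxOn_slab hf.continuousOn (hslice 0) (hslice 2)
      (add_single_zero_mem_slab hp (ν 1)) (by
        simp only [PiLp.add_apply, PiLp.single_apply, if_true]
        exact ⟨by linarith, by linarith⟩) (H 1).2
    exact ⟨z, ⟨⟨hz, slabGrad_eq_zero_of_isLocalMaxOn hf hin hz hzm⟩, hzm⟩, by linarith⟩
  · refine infinite_of_forall_exists_gt_apply fun R => ?_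
    obtain ⟨ν, hν, hR, H⟩ := hseq (R + T) (2 * T)
    obtain ⟨y, hy, hy0, hym⟩ := exists_critPts_not_isLocalMaxOn hf hin hab hδ hp haT hbT hpT hν H
    refine ⟨y, ?_, by linarith⟩
    by_cases hmin : IsLocalMinOn f slab y
    · exact Or.inr ⟨hy, hmin⟩
    · exact Or.inl ⟨hy, hym, hmin⟩

end Zones

section DenseZones

variable {f : EuclideanSpace ℝ (Fin 3) → ℝ}

theorem slab_inter_subset_closure {a b : ℝ} (hab : a < b) :
    slab ∩ {y | y 0 ∈ Icc a b} ⊆ closure (openSlab ∩ {y | y 0 ∈ Ioo a b}) := by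
  rintro y ⟨⟨hy1, hy2⟩, hy0⟩
  set m : EuclideanSpace ℝ (Fin 3) := EuclideanSpace.single 0 ((a + b) / 2)
  have ht : Tendsto (fun s : ℝ => y + s • (m - y)) (𝓝[>] 0) (𝓝 y) := by
    have : ContinuousAt (fun s : ℝ => y + s • (m - y)) 0 := by fun_prop
    simpa [ContinuousAt] using this.mono_left (nhdsWithin_le_nhds (s := Ioi 0))
  refine mem_closure_of_tendsto ht ?_
  have key : ∀ {u v w x s : ℝ}, x ∈ Icc u v → w ∈ Ioo u v → s ∈ Ioc (0 : ℝ) 1 →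
      x + s * (w - x) ∈ Ioo u v := by
    rintro u v w x s ⟨hx1, hx2⟩ ⟨hw1, hw2⟩ ⟨hs1, hs2⟩
    constructor <;> nlinarith
  filter_upwards [Ioc_mem_nhdsGT one_pos] with s hs
  refine ⟨⟨?_, ?_⟩, ?_⟩
  · simpa [m] using key hy1 (w := 0) (by norm_num) hs
  · simpa [m] using key hy2 (w := 0) (by norm_num) hs
  · simpa [m] using key hy0 (w := (a + b) / 2) ⟨by linarith, by linarith⟩ hs

theorem continuousOn_gradSize (hf : ContDiffOn ℝ 1 f slab) : ContinuousOn (gradSize f) slab := by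
  have h := continuousOn_slabGrad hf
  refine continuousOn_finsetSum _ fun i _ => ContinuousOn.abs ?_
  exact (EuclideanSpace.proj (𝕜 := ℝ) i).continuous.comp_continuousOn h

theorem gradSize_pos {x : EuclideanSpace ℝ (Fin 3)} (h : slabGrad f x ≠ 0) : 0 < gradSize f x := by
  have h0 : 0 ≤ gradSize f x := Finset.sum_nonneg fun i _ => abs_nonneg _
  refine lt_of_le_of_ne h0 fun e => h ?_
  ext i
  have := (Finset.sum_eq_zero_iff_of_nonneg fun i _ => abs_nonneg (slabGrad f x i)).1 e.symm i
    (Finset.mem_univ i)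
  simpa using this

/-- The `n`-th approximation of `gradSize` by difference quotients. -/
noncomputable def gradQuotient (f : EuclideanSpace ℝ (Fin 3) → ℝ) (x : EuclideanSpace ℝ (Fin 3))
    (n : ℕ) : ℝ :=
  ∑ j, |(n : ℝ) • (f (x + (n : ℝ)⁻¹ • EuclideanSpace.single j 1) - f x)|

theorem tendsto_gradQuotient (hf : ContDiffOn ℝ 1 f slab) {x : EuclideanSpace ℝ (Fin 3)}
    (hx : x ∈ openSlab) : Tendsto (gradQuotient f x) atTop (𝓝 (gradSize f x)) := by
  have hxs := openSlab_subset hx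
  have h1 : HasFDerivAt f _ x :=
    (((hf.differentiableOn one_ne_zero) _ hxs).hasGradientWithinAt).hasFDerivWithinAt.hasFDerivAt
      (mem_of_superset (isOpen_openSlab.mem_nhds hx) openSlab_subset)
  refine tendsto_finsetSum _ fun j _ => Tendsto.abs ?_
  have h2 := (h1.lim_real (EuclideanSpace.single j 1)).comp tendsto_natCast_atTop_atTop
  have e : InnerProductSpace.toDual ℝ (EuclideanSpace ℝ (Fin 3)) (gradientWithin f slab x)
      (EuclideanSpace.single j 1) = slabGrad f x j := by
    rw [InnerProductSpace.toDual_apply_apply, EuclideanSpace.inner_single_right]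
    simp [slabGrad]
  rw [e] at h2
  exact h2

theorem eventually_add_single_mem {x : EuclideanSpace ℝ (Fin 3)} (hx : x ∈ openSlab) :
    ∀ᶠ n : ℕ in atTop, ∀ j, x + (n : ℝ)⁻¹ • EuclideanSpace.single j 1 ∈ slab := by
  refine eventually_all.2 fun j => ?_
  have h : Tendsto (fun n : ℕ => x + (n : ℝ)⁻¹ • EuclideanSpace.single j (1 : ℝ)) atTop (𝓝 x) := by
    simpa using ((tendsto_inv_atTop_nhds_zero_nat (𝕜 := ℝ)).smul_const
      (EuclideanSpace.single j (1 : ℝ))).const_add x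
  exact h.eventually (mem_of_superset (isOpen_openSlab.mem_nhds hx) openSlab_subset)

/-- A version of `IsZone` which only involves countably many values of the function. -/
def IsDenseZone (f : EuclideanSpace ℝ (Fin 3) → ℝ) (a b δ B r : ℝ) : Prop :=
  ∀ k : ℕ, TopologicalSpace.denseSeq (EuclideanSpace ℝ (Fin 3)) k ∈
      openSlab ∩ {y | y 0 ∈ Ioo a b} →
    |f (TopologicalSpace.denseSeq _ k)| ≤ B ∧ f (TopologicalSpace.denseSeq _ k) ≤ r ∧
    ∀ N : ℕ, ∃ n ≥ N, (∀ j, TopologicalSpace.denseSeq _ k +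
        (n : ℝ)⁻¹ • EuclideanSpace.single j 1 ∈ slab) ∧
      δ ≤ gradQuotient f (TopologicalSpace.denseSeq _ k) n

theorem gradQuotient_add_right (x s : EuclideanSpace ℝ (Fin 3)) (n : ℕ) :
    gradQuotient (fun x => f (x + s)) x n = gradQuotient f (x + s) n := by
  simp only [gradQuotient, add_right_comm x s]

theorem add_single_zero_mem_openSlab {x : EuclideanSpace ℝ (Fin 3)} (hx : x ∈ openSlab) (t : ℝ) :
    x + EuclideanSpace.single 0 t ∈ openSlab := by
  simpa [openSlab] using hx

theorem isDenseZone_of_forall (hf : ContDiffOn ℝ 1 f slab) {a b δ B r t : ℝ}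
    (h : ∀ y ∈ slab, y 0 ∈ Ioo (a + t) (b + t) → δ < gradSize f y ∧ |f y| ≤ B ∧ f y ≤ r) :
    IsDenseZone (fun x => f (x + EuclideanSpace.single 0 t)) a b δ B r := by
  rintro k ⟨hk, hk0⟩
  set x := TopologicalSpace.denseSeq (EuclideanSpace ℝ (Fin 3)) k
  have hxt := add_single_zero_mem_openSlab hk t
  obtain ⟨h1, h2, h3⟩ := h _ (openSlab_subset hxt) (by
    have : x 0 ∈ Ioo a b := hk0
    simpa using this)
  refine ⟨h2, h3, fun N => ?_⟩
  obtain ⟨n, ⟨hn1, hn2⟩, hn3⟩ := ((((tendsto_gradQuotient hf hxt).eventually_const_lt h1).and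
    (eventually_add_single_mem hk)).and (eventually_ge_atTop N)).exists
  exact ⟨n, hn3, hn2, by rw [gradQuotient_add_right]; exact hn1.le⟩

theorem IsDenseZone.isZone (hf : ContDiffOn ℝ 1 f slab) {a b δ B r t : ℝ} (hab : a < b)
    (h : IsDenseZone (fun x => f (x + EuclideanSpace.single 0 t)) a b δ B r) :
    IsZone f (a + t) (b + t) δ B r := by
  set s : EuclideanSpace ℝ (Fin 3) := EuclideanSpace.single 0 t
  have hd : DenseRange fun k => TopologicalSpace.denseSeq (EuclideanSpace ℝ (Fin 3)) k + s :=
    (Homeomorph.addRight s).surjective.denseRange.comp (TopologicalSpace.denseRange_denseSeq _)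
      (Homeomorph.addRight s).continuous
  have hcont : Continuous fun y : EuclideanSpace ℝ (Fin 3) => y 0 := by fun_prop
  set U := openSlab ∩ {y | y 0 ∈ Ioo (a + t) (b + t)}
  have hU : IsOpen U := isOpen_openSlab.inter (isOpen_Ioo.preimage hcont)
  set D := U ∩ range fun k => TopologicalSpace.denseSeq (EuclideanSpace ℝ (Fin 3)) k + s
  have hD : ∀ y ∈ D, δ ≤ gradSize f y ∧ |f y| ≤ B ∧ f y ≤ r := by
    rintro _ ⟨⟨hy, hy0⟩, k, rfl⟩
    have hk : TopologicalSpace.denseSeq (EuclideanSpace ℝ (Fin 3)) k ∈ openSlab := by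
      simpa [openSlab, s] using hy
    obtain ⟨h1, h2, h3⟩ := h k ⟨hk, by
      have : (TopologicalSpace.denseSeq (EuclideanSpace ℝ (Fin 3)) k + s) 0 ∈
        Ioo (a + t) (b + t) := hy0
      simpa [s] using this⟩
    refine ⟨?_, h1, h2⟩
    refine ge_of_tendsto_of_frequently (tendsto_gradQuotient hf hy) (frequently_atTop.2 fun N => ?_)
    obtain ⟨n, hn, -, hn2⟩ := h3 N
    exact ⟨n, hn, by rwa [gradQuotient_add_right] at hn2⟩
  have hDs : D ⊆ slab := fun y hy => openSlab_subset hy.1.1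
  intro y hy hy0
  have hyD : y ∈ closure D := by
    have h1 := slab_inter_subset_closure (by linarith) ⟨hy, hy0⟩
    have h2 : U ⊆ closure D := hd.open_subset_closure_inter hU
    exact closure_minimal h2 isClosed_closure h1
  have : (𝓝[D] y).NeBot := mem_closure_iff_nhdsWithin_neBot.1 hyD
  have hf1 := (hf.continuousOn y hy).mono hDs
  have hf2 := (continuousOn_gradSize hf y hy).mono hDs
  exact ⟨ge_of_tendsto hf2 (eventually_mem_nhdsWithin.mono fun z hz => (hD z hz).1),
    le_of_tendsto hf1.abs (eventually_mem_nhdsWithin.mono fun z hz => (hD z hz).2.1),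
    le_of_tendsto hf1 (eventually_mem_nhdsWithin.mono fun z hz => (hD z hz).2.2)⟩

theorem exists_forall_slab_pos_of_slice {g : EuclideanSpace ℝ (Fin 3) → ℝ} (hg : ContinuousOn g slab)
    {q : ℝ} (h : ∀ y ∈ slab, y 0 = q → 0 < g y) :
    ∃ ε > 0, ∀ y ∈ slab, y 0 ∈ Ioo (q - ε) (q + ε) → 0 < g y := by
  have hcont : Continuous fun y : EuclideanSpace ℝ (Fin 3) => y 0 := by fun_prop
  set A := slab ∩ {y | y 0 ∈ Icc (q - 1) (q + 1)}
  have hA : IsCompact A := isCompact_slab_inter _ _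
  have hbad : IsCompact (A ∩ g ⁻¹' Iic 0) :=
    hA.of_isClosed_subset ((hg.mono inter_subset_left).preimage_isClosed_of_isClosed hA.isClosed
      isClosed_Iic) inter_subset_left
  have hq : q ∉ (fun y : EuclideanSpace ℝ (Fin 3) => y 0) '' (A ∩ g ⁻¹' Iic 0) := by
    rintro ⟨y, hy, hyq⟩
    exact absurd (h y hy.1.1 hyq) (not_lt.2 hy.2)
  obtain ⟨ε, hε, H⟩ := Metric.mem_nhds_iff.1
    ((hbad.image hcont).isClosed.isOpen_compl.mem_nhds hq)
  refine ⟨min ε 1, by positivity, fun y hy hy0 => ?_⟩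
  by_contra hgy
  have h1 := min_le_left ε 1
  have h2 := min_le_right ε 1
  refine H (a := y 0) ?_ ⟨y, ⟨⟨hy, ?_, ?_⟩, not_lt.1 hgy⟩, rfl⟩
  · rw [Metric.mem_ball, Real.dist_eq, abs_lt]
    exact ⟨by linarith [hy0.1], by linarith [hy0.2]⟩
  · linarith [hy0.1]
  · linarith [hy0.2]

/-- The maximum over a slice without critical points is exceeded elsewhere. -/
theorem exists_forall_slice_lt (hf : ContDiffOn ℝ 1 f slab) (hin : GradPointsInward f) {q : ℝ}
    (hq : ∀ y ∈ slab, y 0 = q → slabGrad f y ≠ 0) :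
    ∃ z ∈ slab, ∃ r < f z, ∀ y ∈ slab, y 0 = q → f y ≤ r := by
  have h0 : EuclideanSpace.single 0 q ∈ slab ∩ {y : EuclideanSpace ℝ (Fin 3) | y 0 ∈ Icc q q} := by
    simp [slab]
  obtain ⟨y, hy, Hy⟩ := (isCompact_slab_inter q q).exists_isMaxOn ⟨_, h0⟩
    (hf.continuousOn.mono inter_subset_left)
  have hyq : y 0 = q := le_antisymm hy.2.2 hy.2.1
  have hmax : ∀ z ∈ slab, z 0 = q → f z ≤ f y := fun z hz hzq => Hy ⟨hz, hzq.ge, hzq.le⟩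
  have hyc : y ∈ superComp f (f y - 1) y := Linked.refl hy.1 (by linarith)
  have hm : ∀ z ∈ superComp f (f y - 1) y, z 0 = y 0 → f z ≤ f y := fun z hz hz0 =>
    hmax z hz.right_mem.1 (hz0.trans hyq)
  have hg0 : slabGrad f y 0 ≠ 0 := by
    intro h
    refine hq y hy.1 hyq ?_
    ext i
    fin_cases i
    · exact h
    · exact slabGrad_apply_eq_zero_of_forall_le hf hin hyc hm (by decide)
    · exact slabGrad_apply_eq_zero_of_forall_le hf hin hyc hm (by decide)
  obtain ⟨κ, hκ0, hκ⟩ := exists_between (mul_self_pos.2 hg0)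
  obtain ⟨h, hh, H⟩ := exists_add_smul_mem_superComp hf hyc (hin.admissible_single hy.1 0) hκ0.le
    (by simpa [EuclideanSpace.inner_single_right] using hκ)
  obtain ⟨H1, H2⟩ := H h ⟨hh.le, le_rfl⟩
  exact ⟨_, H1.right_mem.1, f y, by linarith [mul_pos hκ0 hh], hmax⟩

/-- The occurrence of a zone and of a larger value, as a condition on countably many values. -/
def HasZone (f : EuclideanSpace ℝ (Fin 3) → ℝ) (a b δ B r : ℚ) (k : ℕ) : Prop :=
  a < b ∧ 0 < δ ∧ TopologicalSpace.denseSeq (EuclideanSpace ℝ (Fin 3)) k ∈ slab ∧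
    IsDenseZone f a b δ B r ∧ r < f (TopologicalSpace.denseSeq _ k)

theorem exists_hasZone (hf : ContDiffOn ℝ 1 f slab) (hin : GradPointsInward f) {q : ℝ}
    (hq : ∀ y ∈ slab, y 0 = q → slabGrad f y ≠ 0) (t : ℝ) :
    ∃ a b δ B r k, HasZone (fun x => f (x + EuclideanSpace.single 0 t)) a b δ B r k := by
  obtain ⟨z, hz, r₀, hr₀, Hr₀⟩ := exists_forall_slice_lt hf hin hq
  obtain ⟨r, hr, hrz⟩ := exists_rat_btwn hr₀
  have hcont : Continuous fun y : EuclideanSpace ℝ (Fin 3) => y 0 := by fun_prop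
  obtain ⟨δ, hδ, Hδ⟩ : ∃ δ : ℚ, 0 < δ ∧ ∀ y ∈ slab, y 0 = q → (δ : ℝ) < gradSize f y := by
    have h0 : EuclideanSpace.single 0 q ∈ slab ∩ {y : EuclideanSpace ℝ (Fin 3) | y 0 ∈ Icc q q} := by
      simp [slab]
    obtain ⟨y, hy, Hy⟩ := (isCompact_slab_inter q q).exists_isMinOn ⟨_, h0⟩
      ((continuousOn_gradSize hf).mono inter_subset_left)
    obtain ⟨δ, hδ, hδy⟩ := exists_rat_btwn
      (gradSize_pos (hq y hy.1 (le_antisymm hy.2.2 hy.2.1)))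
    exact ⟨δ, by exact_mod_cast hδ, fun z hz hzq => hδy.trans_le (Hy ⟨hz, hzq.ge, hzq.le⟩)⟩
  obtain ⟨ε, hε, Hε⟩ := exists_forall_slab_pos_of_slice
    (g := fun y => min (gradSize f y - δ) (r - f y))
    (ContinuousOn.inf ((continuousOn_gradSize hf).sub continuousOn_const)
      (continuousOn_const.sub hf.continuousOn))
    (fun y hy hyq => lt_min (by linarith [Hδ y hy hyq]) (by linarith [Hr₀ y hy hyq]))
  obtain ⟨B₀, HB₀⟩ := (isCompact_slab_inter (q - ε) (q + ε)).exists_bound_of_continuousOn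
    (hf.continuousOn.mono inter_subset_left)
  obtain ⟨B, hB⟩ := exists_rat_gt B₀
  obtain ⟨a, ha1, ha2⟩ := exists_rat_btwn (show q - ε - t < q - t by linarith)
  obtain ⟨b, hb1, hb2⟩ := exists_rat_btwn (show q - t < q + ε - t by linarith)
  obtain ⟨k, hk1, hk2⟩ : ∃ k, TopologicalSpace.denseSeq (EuclideanSpace ℝ (Fin 3)) k ∈ openSlab ∧
      r < f (TopologicalSpace.denseSeq (EuclideanSpace ℝ (Fin 3)) k +
        EuclideanSpace.single 0 t) := by
    set s : EuclideanSpace ℝ (Fin 3) := EuclideanSpace.single 0 t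
    have hV : IsOpen (openSlab ∩ f ⁻¹' Ioi (r : ℝ)) :=
      (hf.continuousOn.mono openSlab_subset).isOpen_inter_preimage isOpen_openSlab isOpen_Ioi
    have hne : (openSlab ∩ f ⁻¹' Ioi (r : ℝ)).Nonempty := by
      have h1 : z ∈ closure openSlab := closure_mono inter_subset_left
        (slab_inter_subset_closure (a := z 0 - 1) (b := z 0 + 1) (by linarith)
          ⟨hz, by simp⟩)
      have : (𝓝[openSlab] z).NeBot := mem_closure_iff_nhdsWithin_neBot.1 h1
      obtain ⟨w, hw1, hw2⟩ := (eventually_mem_nhdsWithin.and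
        (((hf.continuousOn z hz).mono openSlab_subset).eventually_const_lt hrz)).exists
      exact ⟨w, hw1, hw2⟩
    obtain ⟨w, hw⟩ := hne
    obtain ⟨k, hk⟩ := (TopologicalSpace.denseRange_denseSeq (EuclideanSpace ℝ (Fin 3))).exists_mem_open
      (hV.preimage (Homeomorph.addRight s).continuous) ⟨w - s, by simpa using hw⟩
    refine ⟨k, ?_, hk.2⟩
    simpa [openSlab, s] using hk.1
  refine ⟨a, b, δ, B, r, k, by exact_mod_cast ha2.trans hb1, hδ, openSlab_subset hk1,
    isDenseZone_of_forall hf fun y hy hy0 => ?_, hk2⟩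
  have hy0' : y 0 ∈ Ioo (q - ε) (q + ε) := ⟨by linarith [hy0.1], by linarith [hy0.2]⟩
  obtain ⟨h1, h2⟩ := lt_min_iff.1 (Hε y hy hy0')
  refine ⟨by linarith, ?_, by linarith⟩
  have := HB₀ y ⟨hy, Ioo_subset_Icc_self hy0'⟩
  rw [Real.norm_eq_abs] at this
  linarith

theorem HasZone.exists_slice (hf : ContDiffOn ℝ 1 f slab) {a b δ B r : ℚ} {k : ℕ} {t : ℝ}
    (h : HasZone (fun x => f (x + EuclideanSpace.single 0 t)) a b δ B r k) :
    ∃ q, ∀ y ∈ slab, y 0 = q → slabGrad f y ≠ 0 := by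
  obtain ⟨hab, hδ, -, hz, -⟩ := h
  have hab' : (a : ℝ) < b := by exact_mod_cast hab
  refine ⟨a + t, fun y hy hy0 hg => ?_⟩
  have h1 := (hz.isZone hf hab' y hy ⟨hy0.ge, by linarith⟩).1
  have h2 : (0 : ℝ) < δ := by exact_mod_cast hδ
  simp only [gradSize, hg, PiLp.zero_apply, abs_zero, Finset.sum_const_zero] at h1
  linarith

theorem hasContinuumOfCritPts_of_forall_slice
    (h : ∀ q : ℝ, ∃ y ∈ slab, y 0 = q ∧ slabGrad f y = 0) : HasContinuumOfCritPts f := by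
  choose Y hY1 hY2 hY3 using h
  refine le_antisymm ?_ ?_
  · refine (Cardinal.mk_set_le _).trans ?_
    have e : EuclideanSpace ℝ (Fin 3) ≃ (Fin 3 → ℝ) := WithLp.equiv 2 _
    rw [Cardinal.mk_congr e]
    have h3 := Cardinal.power_nat_le (n := 3) Cardinal.aleph0_le_continuum
    simp only [Cardinal.mk_pi, Cardinal.mk_real, Cardinal.prod_const', Cardinal.mk_fin]
    exact h3
  · rw [← Cardinal.mk_real]
    refine Cardinal.mk_le_of_injective (f := fun q => (⟨Y q, hY1 q, hY3 q⟩ : critPts f)) ?_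
    intro q q' hqq
    have : Y q = Y q' := congrArg Subtype.val hqq
    rw [← hY2 q, ← hY2 q', this]

theorem HasContinuumOfCritPts.infinite (h : HasContinuumOfCritPts f) : (critPts f).Infinite := by
  rw [← Set.infinite_coe_iff, Cardinal.infinite_iff, show Cardinal.mk (critPts f) = _ from h]
  exact Cardinal.aleph0_le_continuum

end DenseZones

section Ergodic

variable {Ω : Type*}

theorem image_flow_eq_preimage [TopologicalSpace Ω] (τ : Flow ℝ Ω) (a : ℝ) (A : Set Ω) : τ a '' A = τ (-a) ⁻¹' A := by
  ext ω
  constructor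
  · rintro ⟨x, hx, rfl⟩
    rw [mem_preimage, ← τ.map_add, neg_add_cancel, τ.map_zero_apply]
    exact hx
  · intro h
    exact ⟨_, h, by rw [← τ.map_add, add_neg_cancel, τ.map_zero_apply]⟩

/-- Zero-one law for events which are invariant along almost every orbit. -/
theorem IsInvariantErgodicProb.ae_mem_or_ae_notMem [MetricSpace Ω]
    [TopologicalSpace.SeparableSpace Ω] [MeasurableSpace Ω] [BorelSpace Ω] {τ : Flow ℝ Ω}
    {P : Measure Ω} (hP : IsInvariantErgodicProb τ P) {A : Set Ω}
    (hA : MeasurableSet A) (h : ∀ᵐ ω ∂P, ∀ t, τ t ω ∈ A ↔ ω ∈ A) :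
    (∀ᵐ ω ∂P, ω ∈ A) ∨ ∀ᵐ ω ∂P, ω ∉ A := by
  have := hP.prob
  have : SecondCountableTopology Ω := UniformSpace.secondCountable_of_separable Ω
  set A' : Set Ω := {ω | ∀ᵐ t ∂(volume : Measure ℝ), τ t ω ∈ A}
  have hA' : MeasurableSet A' := by
    have hS : MeasurableSet {z : Ω × ℝ | τ z.2 z.1 ∉ A} := by
      have hc : Continuous fun z : Ω × ℝ => τ z.2 z.1 := by fun_prop
      exact hc.measurable hA.compl
    exact measurableSet_eq_fun (measurable_measure_prodMk_left (ν := (volume : Measure ℝ)) hS)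
      measurable_const
  have hsub : ∀ a ω, ω ∈ A' → τ a ω ∈ A' := by
    intro a ω hω
    have := (measurePreserving_add_right (volume : Measure ℝ) a).quasiMeasurePreserving.ae hω
    exact this.mono fun t ht => by rwa [← τ.map_add]
  have hinv : ∀ a, τ a '' A' = A' := by
    intro a
    rw [image_flow_eq_preimage]
    refine Subset.antisymm (fun ω hω => ?_) fun ω hω => hsub (-a) ω hω
    have := hsub a _ hω
    rwa [← τ.map_add, add_neg_cancel, τ.map_zero_apply] at this
  have heq : ∀ᵐ ω ∂P, ω ∈ A' ↔ ω ∈ A := by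
    filter_upwards [h] with ω hω
    simp [A', hω]
  rcases hP.ergodic A' hA' hinv with h1 | h0
  · left
    filter_upwards [heq, (prob_compl_eq_zero_iff hA').2 h1] with ω h2 h3
    exact h2.1 h3
  · right
    filter_upwards [heq, measure_eq_zero_iff_ae_notMem.1 h0] with ω h2 h3
    exact fun h4 => h3 (h2.2 h4)

theorem IsInvariantErgodicProb.ae_frequently_mem [TopologicalSpace Ω] [MeasurableSpace Ω]
    [BorelSpace Ω] {τ : Flow ℝ Ω} {P : Measure Ω} (hP : IsInvariantErgodicProb τ P) {A : Set Ω}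
    (hA : MeasurableSet A) : ∀ᵐ ω ∂P, ω ∈ A → ∃ᶠ n : ℕ in atTop, τ (n : ℝ) ω ∈ A := by
  have := hP.prob
  have hmp : MeasurePreserving (τ 1) P P := by
    have hm : Measurable (τ 1) := (τ.continuous_toFun 1).measurable
    refine ⟨hm, Measure.ext fun B hB => ?_⟩
    rw [Measure.map_apply hm hB, ← hP.preserving (-1) B hB, image_flow_eq_preimage, neg_neg]
  have hit : ∀ (n : ℕ) (ω : Ω), (τ 1)^[n] ω = τ (n : ℝ) ω := by
    intro n ω
    induction n with
    | zero => simp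
    | succ n ih => rw [Function.iterate_succ_apply', ih, ← τ.map_add, Nat.cast_succ, add_comm]
  filter_upwards [hmp.conservative.ae_mem_imp_frequently_image_mem hA.nullMeasurableSet] with ω h h'
  simpa only [hit] using h h'

variable {Kbar : Ω → ℝ → ℝ → ℝ}

theorem stationaryFun_flow [TopologicalSpace Ω] {τ : Flow ℝ Ω} (t : ℝ) (ω : Ω) : stationaryFun τ Kbar (τ t ω) =
    fun x => stationaryFun τ Kbar ω (x + EuclideanSpace.single 0 t) := by
  funext x
  simp [stationaryFun, τ.map_add]

theorem measurable_stationaryFun [TopologicalSpace Ω] [MeasurableSpace Ω] [BorelSpace Ω]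
    {τ : Flow ℝ Ω}
    (hmeas : Measurable fun z : Ω × Icc (-1 : ℝ) 1 × Icc (-1 : ℝ) 1 => Kbar z.1 z.2.1 z.2.2)
    {x : EuclideanSpace ℝ (Fin 3)} (hx : x ∈ slab) :
    Measurable fun ω => stationaryFun τ Kbar ω x := by
  have h : Measurable fun ω : Ω =>
      ((τ (x 0) ω, ⟨x 1, hx.1⟩, ⟨x 2, hx.2⟩) : Ω × Icc (-1 : ℝ) 1 × Icc (-1 : ℝ) 1) :=
    (τ.continuous_toFun (x 0)).measurable.prodMk measurable_const
  exact hmeas.comp h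

theorem measurableSet_hasZone [TopologicalSpace Ω] [MeasurableSpace Ω] [BorelSpace Ω]
    {τ : Flow ℝ Ω}
    (hmeas : Measurable fun z : Ω × Icc (-1 : ℝ) 1 × Icc (-1 : ℝ) 1 => Kbar z.1 z.2.1 z.2.2)
    (a b δ B r : ℚ) (k : ℕ) :
    MeasurableSet {ω | HasZone (stationaryFun τ Kbar ω) a b δ B r k} := by
  have hm := fun x hx => measurable_stationaryFun (τ := τ) hmeas (x := x) hx
  have hle : ∀ {g h : Ω → ℝ}, Measurable g → Measurable h → Measurable fun ω => g ω ≤ h ω :=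
    fun hg hh => measurableSet_setOfPred.1 (measurableSet_le hg hh)
  refine measurableSet_setOfPred.2 (measurable_const.and (measurable_const.and ?_))
  by_cases hk : TopologicalSpace.denseSeq (EuclideanSpace ℝ (Fin 3)) k ∈ slab
  swap
  · simp only [hk, false_and]
    exact measurable_const
  refine measurable_const.and (Measurable.and ?_
    (measurableSet_setOfPred.1 (measurableSet_lt measurable_const (hm _ hk))))
  refine Measurable.forall fun k => Measurable.forall fun hk => ?_
  have hks := hm _ (openSlab_subset hk.1)
  refine (hle hks.abs measurable_const).and ((hle hks measurable_const).and ?_)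
  refine Measurable.forall fun N => Measurable.exists fun n => measurable_const.and ?_
  by_cases hn : ∀ j, TopologicalSpace.denseSeq _ k +
      (n : ℝ)⁻¹ • EuclideanSpace.single j (1 : ℝ) ∈ slab
  swap
  · simp only [hn, false_and]
    exact measurable_const
  refine measurable_const.and (hle measurable_const ?_)
  exact Finset.measurable_sum _ fun j _ => (((hm _ (hn j)).sub hks).const_smul (n : ℝ)).abs

end Ergodic

theorem mainTheorem5 {Ω : Type*} [MetricSpace Ω] [TopologicalSpace.SeparableSpace Ω]
    [MeasurableSpace Ω] [BorelSpace Ω] (τ : Flow ℝ Ω) (P : Measure Ω)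
    (hP : IsInvariantErgodicProb τ P)
    (Kbar : Ω → ℝ → ℝ → ℝ)
    (hmeas : Measurable fun z : Ω × Icc (-1 : ℝ) 1 × Icc (-1 : ℝ) 1 => Kbar z.1 z.2.1 z.2.2)
    (hC1 : ∀ᵐ ω ∂P, ContDiffOn ℝ 1 (stationaryFun τ Kbar ω) slab)
    (hin : ∀ᵐ ω ∂P, GradPointsInward (stationaryFun τ Kbar ω)) :
    (∀ᵐ ω ∂P, (critPts (stationaryFun τ Kbar ω)).Infinite) ∧
    ((∀ᵐ ω ∂P, HasContinuumOfCritPts (stationaryFun τ Kbar ω)) ∨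
      (∀ᵐ ω ∂P, (localMaxPts (stationaryFun τ Kbar ω)).Infinite ∧
        (saddlePts (stationaryFun τ Kbar ω) ∪
          localMinPts (stationaryFun τ Kbar ω)).Infinite)) := by
  set A : ℚ × ℚ × ℚ × ℚ × ℚ × ℕ → Set Ω := fun c =>
    {ω | HasZone (stationaryFun τ Kbar ω) c.1 c.2.1 c.2.2.1 c.2.2.2.1 c.2.2.2.2.1 c.2.2.2.2.2}
  have hA : ∀ c, MeasurableSet (A c) := fun c => measurableSet_hasZone hmeas _ _ _ _ _ _
  have hiff : ∀ᵐ ω ∂P, ∀ t, τ t ω ∈ ⋃ c, A c ↔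
      ∃ q, ∀ y ∈ slab, y 0 = q → slabGrad (stationaryFun τ Kbar ω) y ≠ 0 := by
    filter_upwards [hC1, hin] with ω hf hi t
    simp only [A, mem_iUnion, mem_ofPred_eq, stationaryFun_flow]
    constructor
    · rintro ⟨c, hc⟩
      exact hc.exists_slice hf
    · rintro ⟨q, hq⟩
      obtain ⟨a, b, δ, B, r, k, h⟩ := exists_hasZone hf hi hq t
      exact ⟨(a, b, δ, B, r, k), h⟩
  have hrec : ∀ᵐ ω ∂P, ∀ c, ω ∈ A c → ∃ᶠ n : ℕ in atTop, τ (n : ℝ) ω ∈ A c :=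
    ae_all_iff.2 fun c => hP.ae_frequently_mem (hA c)
  rcases hP.ae_mem_or_ae_notMem (MeasurableSet.iUnion hA) (by
    filter_upwards [hiff] with ω h t
    rw [h t, ← h 0, τ.map_zero_apply]) with hE | hE
  · have key : ∀ᵐ ω ∂P, (localMaxPts (stationaryFun τ Kbar ω)).Infinite ∧
        (saddlePts (stationaryFun τ Kbar ω) ∪
          localMinPts (stationaryFun τ Kbar ω)).Infinite := by
      filter_upwards [hC1, hin, hrec, hE] with ω hf hi hr hω
      obtain ⟨c, hc⟩ := mem_iUnion.1 hω
      have hab : (c.1 : ℝ) < c.2.1 := by exact_mod_cast hc.1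
      have hδ : (0 : ℝ) < c.2.2.1 := by exact_mod_cast hc.2.1
      refine infinite_localMaxPts_and_infinite_saddlePts_union hf hi hab hδ hc.2.2.1
        ((hr c hc).mono fun n hn => ?_) (B := c.2.2.2.1) (r := c.2.2.2.2.1)
      simp only [A, mem_ofPred_eq, stationaryFun_flow] at hn
      exact ⟨hn.2.2.2.1.isZone hf hab, hn.2.2.2.2⟩
    exact ⟨key.mono fun ω h => h.1.mono fun x hx => hx.1, Or.inr key⟩
  · have key : ∀ᵐ ω ∂P, HasContinuumOfCritPts (stationaryFun τ Kbar ω) := by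
      filter_upwards [hiff, hE] with ω h hω
      refine hasContinuumOfCritPts_of_forall_slice fun q => ?_
      by_contra! hq
      refine hω ?_
      rw [← τ.map_zero_apply ω]
      exact (h 0).2 ⟨q, hq⟩
    exact ⟨key.mono fun ω h => h.infinite, Or.inl key⟩
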